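/- Let $\mathbb{T}=\mathbb{R}/\mathbb{Z}$. There exists a full Lebesgue measure set $\mathcal{F}'\subset\mathbb{T}\times\mathbb{T}^2\times\mathbb{T}^2$ such that for every $(\alpha,\mathbf{p},\mathbf{q})\in\mathcal{F}'$ (with $\alpha$ represented by any real number) the following holds. Let $\varphi:\mathbb{T}^2\to\mathbb{R}_{\ge 0}$ be any $C^3$ function which vanishes at exactly the two distinct points $\mathbf{p}$ and $\mathbf{q}$ and whose Hessians $D^2\varphi(\mathbf{p})$, $D^2\varphi(\mathbf{q})$ are positive definite, and let $(T_t)_{t\in\mathbb{R}}$ be the flow on $\mathbb{T}^2$ generated by the vector field $\varphi\cdot(1,\alpha)$ (which exists). Then the $(T_t)$-invariant Borel probability measures are exactly the convex combinations $c\,\delta_{\mathbf{p}}+(1-c)\,\delta_{\mathbf{q}}$, $c\in[0,1]$, and $(T_t)$ has extreme historic behavior: for Lebesgue-a.e. $\mathbf{x}\in\mathbb{T}^2$, the set of accumulation points, as $t\to\infty$ and in the weak topology, of the empirical measures $$\mu_t(\mathbf{x})(f)=\frac1t\int_0^t f(T_s\mathbf{x})\,\mathrm{d}s,\qquad f\in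 C(\mathbb{T}^2),$$ is exactly the set of $(T_t)$-invariant probability measures. -/

import Mathlib

open MeasureTheory Filter Topology

noncomputable section

namespace TorusFlow

/-- The two-torus `ℝ²/ℤ²`; its `volume` is normalized Lebesgue measure. -/
abbrev Torus2 : Type := UnitAddCircle × UnitAddCircle

/-- The covering projection `ℝ² → 𝕋²`. -/
def proj (v : ℝ × ℝ) : Torus2 := ((v.1 : UnitAddCircle), (v.2 : UnitAddCircle))

/-- The Hessian of `φ` at the point `p` of the torus is positive definite (computed on the universal
cover; by periodicity the choice of the lift `P` of `p` does not matter). -/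
def HasPosDefHessianAt (φ : Torus2 → ℝ) (p : Torus2) : Prop :=
  ∀ P : ℝ × ℝ, proj P = p → ∀ v : ℝ × ℝ, v ≠ 0 →
    0 < fderiv ℝ (fderiv ℝ (fun w : ℝ × ℝ => φ (proj w))) P v v

/-- `φ` is a `C³` non-negative function on the torus which vanishes at exactly the two points
`p` and `q`, with positive definite Hessian at both. -/
structure IsStoppingFunction (φ : Torus2 → ℝ) (p q : Torus2) : Prop where
  contDiff : ContDiff ℝ 3 (fun w : ℝ × ℝ => φ (proj w))
  nonneg : ∀ x, 0 ≤ φ x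
  ne : p ≠ q
  eq_zero_iff : ∀ x, φ x = 0 ↔ x = p ∨ x = q
  hessian_left : HasPosDefHessianAt φ p
  hessian_right : HasPosDefHessianAt φ q

/-- The flow `T` is generated by the vector field `φ · (1, a)`: every orbit lifts to an
integral curve in `ℝ²` of the lifted vector field. -/
def IsGeneratedBy (T : Flow ℝ Torus2) (φ : Torus2 → ℝ) (a : ℝ) : Prop :=
  ∀ x : Torus2, ∃ γ : ℝ → ℝ × ℝ, (∀ t, T t x = proj (γ t)) ∧
    ∀ t, HasDerivAt γ (φ (proj (γ t)) • ((1 : ℝ), a)) t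

/-- The value `μ_t(x)(f) = (1/t) ∫₀ᵗ f (T_s x) ds` of the empirical measure at time `t`. -/
def empirical (T : Flow ℝ Torus2) (x : Torus2) (t : ℝ) (f : C(Torus2, ℝ)) : ℝ :=
  t⁻¹ * ∫ s in (0 : ℝ)..t, f (T s x)

/-- The accumulation points, as `t → ∞` and in the weak topology, of the empirical measures of
the point `x`. -/
def accumulationMeasures (T : Flow ℝ Torus2) (x : Torus2) : Set (Measure Torus2) :=
  {ν | IsProbabilityMeasure ν ∧ ∃ τ : ℕ → ℝ, Tendsto τ atTop atTop ∧
    ∀ f : C(Torus2, ℝ), Tendsto (fun n => empirical T x (τ n) f) atTop (𝓝 (∫ y, f y ∂ν))}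

/-- The `T`-invariant Borel probability measures. -/
def invariantMeasures (T : Flow ℝ Torus2) : Set (Measure Torus2) :=
  {ν | IsProbabilityMeasure ν ∧ ∀ t : ℝ, MeasurePreserving (T t) ν ν}

/-- Extreme historic behavior: for a.e. point, the accumulation points of the empirical measures
are exactly the invariant probability measures. -/
def HasExtremeHistoricBehavior (T : Flow ℝ Torus2) : Prop :=
  ∀ᵐ x : Torus2, accumulationMeasures T x = invariantMeasures T

/-- The convex combinations of `δ_p` and `δ_q`. -/
def diracSegment (p q : Torus2) : Set (Measure Torus2) :=
  {ν | ∃ c : ℝ, 0 ≤ c ∧ c ≤ 1 ∧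
    ν = ENNReal.ofReal c • Measure.dirac p + ENNReal.ofReal (1 - c) • Measure.dirac q}

end TorusFlow

end

open MeasureTheory Filter Topology

noncomputable section

namespace TorusFlow

/-! Every orbit runs along an irrational line as `x + line a (θ t)` with `θ' = φ`, so the proof
compares travel times. Since `φ` vanishes at least quadratically at `p`, `1 / φ` has infinite
integral in dimension two. Weyl equidistribution for the continuous functions `1 / (φ + η)` then
yields `θ t = o(t)` (`IsParam.eventually_le`). As `θ t` is the integral of `φ` along the orbit, time
averages of continuous functions vanishing at both zeros tend to zero
(`IsStoppingFunction.tendsto_empirical`). Hence invariant measures and accumulation points integrate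
`φ` to zero and live on the two zeros.

Conversely, the averages of a function equal to 1 at `p` and 0 at `q` are continuous in `t`. By the
intermediate value theorem the whole segment is reached once these averages come arbitrarily close
to both ends at late times (`IsStoppingFunction.diracSegment_subset`).

To see that they do, follow the crossings of the line with the vertical circles through `p` and `q`:
the offsets from these points are orbits `u + k α` and `v + k α` of a rotation. Reaching a crossing
at distance `d` from `p` costs time at least of order `1 / d`, while the positive definite Hessian
at `q` bounds the time near `q` up to the `n`-th crossing by a multiple of the sum of `1 / ‖v + k
α‖`, typically of order `n log n`. The events `‖u + n α‖ ≤ η / (n log n)` are pairwise independent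
in `(α, u)` with divergent total probability, and the sum is tame with large conditional probability
given `(α, u)`; a Borel–Cantelli argument makes both happen infinitely often
(`measure_not_frequently_le`, `ae_isDominant`). At those moments the time near `p` dominates
(`IsDominant.exists_empirical_lt`). Exchanging `p` and `q` gives the other end, and Fubini carries
the result from `(u, v)` to the zeros and the starting point. -/

/-! ### Lines, lifts and norms on the torus -/

/-- The one-parameter subgroup of the torus with direction `(1, a)`. -/
def line (a σ : ℝ) : Torus2 := ((σ : UnitAddCircle), ((a * σ : ℝ) : UnitAddCircle))

lemma line_eq_proj (a σ : ℝ) : line a σ = proj (σ • ((1 : ℝ), a)) := by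
  simp [line, proj, mul_comm]

lemma line_add (a σ τ : ℝ) : line a (σ + τ) = line a σ + line a τ := by
  simp [line, mul_add]

lemma continuous_proj : Continuous proj :=
  ((AddCircle.continuous_mk' 1).comp continuous_fst).prodMk
    ((AddCircle.continuous_mk' 1).comp continuous_snd)

lemma continuous_line (a : ℝ) : Continuous (line a) :=
  (AddCircle.continuous_mk' 1).prodMk
    ((AddCircle.continuous_mk' 1).comp (continuous_const.mul continuous_id))

lemma proj_add (v w : ℝ × ℝ) : proj (v + w) = proj v + proj w := by
  simp [proj]

lemma proj_surjective : Function.Surjective proj := by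
  rintro ⟨x, y⟩
  obtain ⟨x, rfl⟩ := QuotientAddGroup.mk_surjective x
  obtain ⟨y, rfl⟩ := QuotientAddGroup.mk_surjective y
  exact ⟨(x, y), rfl⟩

lemma isOpenQuotientMap_proj : IsOpenQuotientMap proj :=
  (QuotientAddGroup.isOpenQuotientMap_mk (N := AddSubgroup.zmultiples (1 : ℝ))).prodMap
    (QuotientAddGroup.isOpenQuotientMap_mk (N := AddSubgroup.zmultiples (1 : ℝ)))

lemma coe_int_circle (n : ℤ) : ((n : ℝ) : UnitAddCircle) = 0 :=
  AddCircle.coe_eq_zero_iff (1 : ℝ) |>.2 ⟨n, by simp⟩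

lemma exists_int_of_coe_eq {v w : ℝ} (h : (v : UnitAddCircle) = w) : ∃ m : ℤ, v = w + m := by
  have h' : ((v - w : ℝ) : UnitAddCircle) = 0 := by simp [h]
  obtain ⟨m, hm⟩ := (AddCircle.coe_eq_zero_iff (1 : ℝ)).1 h'
  exact ⟨m, by simp at hm; linarith⟩

lemma exists_int_of_proj_eq {v w : ℝ × ℝ} (h : proj v = proj w) :
    ∃ m n : ℤ, v = w + ((m : ℝ), (n : ℝ)) := by
  obtain ⟨h1, h2⟩ := Prod.ext_iff.1 h
  obtain ⟨m, hm⟩ := exists_int_of_coe_eq h1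
  obtain ⟨n, hn⟩ := exists_int_of_coe_eq h2
  exact ⟨m, n, Prod.ext hm hn⟩

lemma proj_int (m n : ℤ) : proj ((m : ℝ), (n : ℝ)) = 0 := by
  simp [proj, coe_int_circle]

lemma exists_lift_circle (z : UnitAddCircle) : ∃ w : ℝ, (w : UnitAddCircle) = z ∧ |w| = ‖z‖ := by
  obtain ⟨w, rfl⟩ := QuotientAddGroup.mk_surjective z
  refine ⟨w - round w, ?_, ?_⟩
  · simp [coe_int_circle]
  · exact (UnitAddCircle.norm_eq).symm

/-- Every point of the torus has a lift whose norm is the distance of the point from the origin. -/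
lemma exists_lift (z : Torus2) : ∃ w : ℝ × ℝ, proj w = z ∧ ‖w‖ = ‖z‖ := by
  obtain ⟨w1, h1, h1'⟩ := exists_lift_circle z.1
  obtain ⟨w2, h2, h2'⟩ := exists_lift_circle z.2
  exact ⟨(w1, w2), Prod.ext h1 h2, by simp [Prod.norm_def, h1', h2']⟩

lemma norm_coe_circle_le (w : ℝ) : ‖(w : UnitAddCircle)‖ ≤ |w| := by
  rw [UnitAddCircle.norm_eq]
  simpa using round_le w 0

lemma norm_torus_le (z : Torus2) : ‖z‖ ≤ 1 := by
  have h (y : UnitAddCircle) : ‖y‖ ≤ 1 := by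
    have := AddCircle.norm_le_half_period (1 : ℝ) (x := y) one_ne_zero
    norm_num at this
    linarith
  exact max_le (h _) (h _)

/-! ### Quadratic behaviour of `φ` at its zeros -/

section Local

variable {φ : Torus2 → ℝ} {p q : Torus2}

lemma IsStoppingFunction.symm (h : IsStoppingFunction φ p q) : IsStoppingFunction φ q p :=
  ⟨h.contDiff, h.nonneg, h.ne.symm, fun x => (h.eq_zero_iff x).trans or_comm, h.hessian_right,
    h.hessian_left⟩

lemma IsStoppingFunction.continuous (h : IsStoppingFunction φ p q) : Continuous φ :=
  isOpenQuotientMap_proj.isQuotientMap.continuous_iff.2 h.contDiff.continuous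

lemma IsStoppingFunction.left_eq_zero (h : IsStoppingFunction φ p q) : φ p = 0 :=
  (h.eq_zero_iff p).2 (Or.inl rfl)

lemma IsStoppingFunction.pos (h : IsStoppingFunction φ p q) {x : Torus2} (hp : x ≠ p)
    (hq : x ≠ q) : 0 < φ x :=
  lt_of_le_of_ne (h.nonneg x) fun h0 => by
    rcases (h.eq_zero_iff x).1 h0.symm with h | h <;> contradiction

lemma IsStoppingFunction.exists_le (h : IsStoppingFunction φ p q) :
    ∃ M : ℝ, 0 < M ∧ ∀ x, φ x ≤ M := by
  obtain ⟨M, hM⟩ := isCompact_univ.bddAbove_image (f := φ) h.continuous.continuousOn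
  exact ⟨max M 1, by positivity, fun x => (hM ⟨x, trivial, rfl⟩).trans (le_max_left _ _)⟩

/-- The derivative of the lift is periodic, so its bound on the unit square is global. -/
lemma IsStoppingFunction.exists_lipschitz (h : IsStoppingFunction φ p q) :
    ∃ K : NNReal, LipschitzWith K (fun w : ℝ × ℝ => φ (proj w)) := by
  set F := fun w : ℝ × ℝ => φ (proj w) with hF
  have hc : Continuous (fderiv ℝ F) := h.contDiff.continuous_fderiv (by norm_num)
  have hper : ∀ (m n : ℤ) (w : ℝ × ℝ), fderiv ℝ F (w + ((m : ℝ), (n : ℝ))) = fderiv ℝ F w := by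
    intro m n w
    rw [← fderiv_comp_add_right]
    congr 1
    funext v
    simp [hF, proj_add, proj_int]
  obtain ⟨M, hM⟩ := (isCompact_Icc (a := ((0 : ℝ), (0 : ℝ))) (b := (1, 1))).bddAbove_image
    (f := fun w => ‖fderiv ℝ F w‖₊) hc.nnnorm.continuousOn
  refine ⟨M, lipschitzWith_of_nnnorm_fderiv_le (h.contDiff.differentiable (by norm_num)) ?_⟩
  intro w
  have := hper (-⌊w.1⌋) (-⌊w.2⌋) w
  rw [← this]
  refine hM ⟨_, ⟨⟨?_, ?_⟩, ⟨?_, ?_⟩⟩, rfl⟩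
  · simpa using Int.floor_le w.1
  · simpa using Int.floor_le w.2
  · have := Int.lt_floor_add_one w.1
    simp; linarith
  · have := Int.lt_floor_add_one w.2
    simp; linarith

/-- Second order Taylor expansion at a critical point. -/
lemma taylor_two {F : ℝ × ℝ → ℝ} (hF : ContDiff ℝ 2 F) {P : ℝ × ℝ} (h0 : F P = 0)
    (h1 : fderiv ℝ F P = 0) {ε : ℝ} (hε : 0 < ε) :
    ∃ δ > 0, ∀ w : ℝ × ℝ, ‖w‖ < δ →
      |F (P + w) - 2⁻¹ * fderiv ℝ (fderiv ℝ F) P w w| ≤ ε * ‖w‖ ^ 2 := by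
  have hd : DifferentiableAt ℝ (fderiv ℝ F) P :=
    ((hF.fderiv_right (m := 1) (by norm_num)).differentiable (by norm_num)) P
  have ho := (hasFDerivAt_iff_isLittleO_nhds_zero.1 hd.hasFDerivAt).def hε
  obtain ⟨δ, hδ, hb⟩ := Metric.eventually_nhds_iff.1 ho
  refine ⟨δ, hδ, fun w hw => ?_⟩
  set H := fderiv ℝ (fderiv ℝ F) P with hH
  -- The mean value inequality on the segment from `P` to `P + w` reduces the claim to the
  -- first-order expansion of the derivative at `P`.
  have hder : ∀ t ∈ Set.Icc (0 : ℝ) 1, HasDerivWithinAt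
      (fun t : ℝ => F (P + t • w) - 2⁻¹ * t ^ 2 * H w w)
      (fderiv ℝ F (P + t • w) w - t * H w w) (Set.Icc 0 1) t := by
    intro t _
    have e1 : HasDerivAt (fun t : ℝ => P + t • w) w t := by
      simpa using ((hasDerivAt_id t).smul_const w).const_add P
    have e2 := ((hF.differentiable (by norm_num)) (P + t • w)).hasFDerivAt.comp_hasDerivAt t e1
    have e3 : HasDerivAt (fun t : ℝ => 2⁻¹ * t ^ 2 * H w w) (t * H w w) t := by
      have := ((hasDerivAt_pow 2 t).const_mul (2⁻¹ : ℝ)).mul_const (H w w)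
      refine this.congr_deriv ?_
      norm_num
      exact Or.inl (by ring)
    exact (e2.sub e3).hasDerivWithinAt
  have hbound : ∀ t ∈ Set.Ico (0 : ℝ) 1,
      ‖fderiv ℝ F (P + t • w) w - t * H w w‖ ≤ ε * ‖w‖ ^ 2 := by
    intro t ht
    have hn : ‖t • w‖ ≤ ‖w‖ := by
      rw [norm_smul, Real.norm_of_nonneg ht.1]
      exact mul_le_of_le_one_left (norm_nonneg _) ht.2.le
    have := hb (y := t • w) (by simpa using hn.trans_lt hw)
    rw [h1, sub_zero] at this
    have e : fderiv ℝ F (P + t • w) w - t * H w w = (fderiv ℝ F (P + t • w) - H (t • w)) w := by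
      simp
    rw [e]
    calc _ ≤ ‖fderiv ℝ F (P + t • w) - H (t • w)‖ * ‖w‖ := ContinuousLinearMap.le_opNorm _ _
      _ ≤ (ε * ‖w‖) * ‖w‖ := by gcongr; exact this.trans (by gcongr)
      _ = _ := by ring
  have := norm_image_sub_le_of_norm_deriv_le_segment_01' hder hbound
  simpa [h0] using this

lemma IsStoppingFunction.taylor (h : IsStoppingFunction φ p q) {P : ℝ × ℝ} (hP : proj P = p)
    {ε : ℝ} (hε : 0 < ε) :
    ∃ δ > 0, ∀ w : ℝ × ℝ, ‖w‖ < δ → |φ (p + proj w) -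
      2⁻¹ * fderiv ℝ (fderiv ℝ (fun w : ℝ × ℝ => φ (proj w))) P w w| ≤ ε * ‖w‖ ^ 2 := by
  have h0 : φ (proj P) = 0 := by rw [hP, h.left_eq_zero]
  have h1 : fderiv ℝ (fun w : ℝ × ℝ => φ (proj w)) P = 0 := by
    apply IsLocalMin.fderiv_eq_zero
    exact Eventually.of_forall fun w => by simpa [h0] using h.nonneg (proj w)
  obtain ⟨δ, hδ, hb⟩ := taylor_two (h.contDiff.of_le (by norm_num)) h0 h1 hε
  exact ⟨δ, hδ, fun w hw => by simpa [proj_add, hP] using hb w hw⟩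

/-- `φ` is bounded by a multiple of the squared distance to a zero. -/
lemma IsStoppingFunction.exists_le_sq (h : IsStoppingFunction φ p q) :
    ∃ C > 0, ∀ x, φ x ≤ C * ‖x - p‖ ^ 2 := by
  obtain ⟨P, hP⟩ := proj_surjective p
  obtain ⟨δ, hδ, hb⟩ := h.taylor hP one_pos
  obtain ⟨M, hM, hM'⟩ := h.exists_le
  set H := fderiv ℝ (fderiv ℝ (fun w : ℝ × ℝ => φ (proj w))) P
  refine ⟨max (2⁻¹ * ‖H‖ + 1) (M / δ ^ 2), by positivity, fun x => ?_⟩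
  obtain ⟨w, hw, hw'⟩ := exists_lift (x - p)
  rw [← hw']
  rcases lt_or_ge ‖w‖ δ with hlt | hge
  · have h1 := (abs_le.1 (hb w hlt)).2
    rw [hw, add_sub_cancel] at h1
    have h2 : H w w ≤ ‖H‖ * ‖w‖ * ‖w‖ := (le_abs_self _).trans (H.le_opNorm₂ w w)
    calc φ x ≤ (2⁻¹ * ‖H‖ + 1) * ‖w‖ ^ 2 := by nlinarith
      _ ≤ _ := by gcongr; exact le_max_left _ _
  · calc φ x ≤ M / δ ^ 2 * δ ^ 2 := by rw [div_mul_cancel₀ _ (by positivity)]; exact hM' x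
      _ ≤ M / δ ^ 2 * ‖w‖ ^ 2 := by gcongr
      _ ≤ _ := by gcongr; exact le_max_right _ _

/-- Near a non-degenerate zero, `φ` dominates a multiple of the squared distance to it. -/
lemma IsStoppingFunction.exists_sq_le (h : IsStoppingFunction φ p q) :
    ∃ c > 0, ∃ δ > 0, ∀ x, ‖x - p‖ < δ → c * ‖x - p‖ ^ 2 ≤ φ x := by
  obtain ⟨P, hP⟩ := proj_surjective p
  set H := fderiv ℝ (fderiv ℝ (fun w : ℝ × ℝ => φ (proj w))) P with hH
  have hpos : ∀ v : ℝ × ℝ, v ≠ 0 → 0 < H v v := h.hessian_left P hP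
  have hcont : Continuous fun v : ℝ × ℝ => H v v :=
    H.continuous.clm_apply continuous_id
  obtain ⟨v₀, hv₀, hmin⟩ := (isCompact_sphere (0 : ℝ × ℝ) 1).exists_isMinOn
    ⟨((1 : ℝ), (0 : ℝ)), by simp [Prod.norm_def]⟩ hcont.continuousOn
  have hc : 0 < H v₀ v₀ := hpos v₀ fun h0 => by simp [h0] at hv₀
  set c := H v₀ v₀
  have hlow : ∀ w : ℝ × ℝ, c * ‖w‖ ^ 2 ≤ H w w := by
    intro w
    rcases eq_or_ne w 0 with rfl | hw
    · simp
    have hn : 0 < ‖w‖ := norm_pos_iff.2 hw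
    have h1 : c ≤ H (‖w‖⁻¹ • w) (‖w‖⁻¹ • w) :=
      hmin (show ‖w‖⁻¹ • w ∈ Metric.sphere (0 : ℝ × ℝ) 1 by simp [norm_smul, hn.ne'])
    have h2 : H (‖w‖⁻¹ • w) (‖w‖⁻¹ • w) * ‖w‖ ^ 2 = H w w := by
      simp only [map_smul, smul_apply, smul_eq_mul]
      field_simp
    rw [← h2]
    gcongr
  -- Half the Hessian form is at least `c / 2` times the squared norm; an error of `c / 4` leaves `c
  -- / 4`.
  obtain ⟨δ, hδ, hb⟩ := h.taylor hP (ε := c / 4) (by positivity)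
  refine ⟨c / 4, by positivity, δ, hδ, fun x hx => ?_⟩
  obtain ⟨w, hw, hw'⟩ := exists_lift (x - p)
  rw [← hw'] at hx ⊢
  have h1 := (abs_le.1 (hb w hx)).1
  rw [hw, add_sub_cancel] at h1
  have := hlow w
  nlinarith

/-- A continuous function vanishing at both zeros of `φ` is controlled by `φ`. -/
lemma IsStoppingFunction.exists_abs_le (h : IsStoppingFunction φ p q) (f : C(Torus2, ℝ))
    (hp : f p = 0) (hq : f q = 0) {ε : ℝ} (hε : 0 < ε) :
    ∃ C, 0 ≤ C ∧ ∀ x, |f x| ≤ ε + C * φ x := by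
  have hK : IsCompact {x | ε ≤ |f x|} :=
    (isClosed_le continuous_const f.continuous.abs).isCompact
  have hpos : ∀ x ∈ {x | ε ≤ |f x|}, 0 < φ x := by
    intro x hx
    refine h.pos ?_ ?_ <;> rintro rfl <;> simp [hp, hq] at hx <;> linarith
  obtain ⟨C, hC⟩ := hK.bddAbove_image (f := fun x => |f x| / φ x)
    (f.continuous.abs.continuousOn.div h.continuous.continuousOn fun x hx => (hpos x hx).ne')
  refine ⟨max C 0, le_max_right _ _, fun x => ?_⟩
  have hφ := h.nonneg x
  rcases lt_or_ge |f x| ε with hx | hx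
  · have : 0 ≤ max C 0 * φ x := by positivity
    linarith
  · have h1 : |f x| / φ x ≤ C := hC ⟨x, hx, rfl⟩
    rw [div_le_iff₀ (hpos x hx)] at h1
    have : C * φ x ≤ max C 0 * φ x := by gcongr; exact le_max_left _ _
    linarith

/-- A continuous function vanishing at `p` is controlled by `φ` divided by the squared distance
to the other zero `q`. -/
lemma IsStoppingFunction.exists_abs_mul_sq_le (h : IsStoppingFunction φ p q) (g : C(Torus2, ℝ))
    (hp : g p = 0) {ε : ℝ} (hε : 0 < ε) :
    ∃ C, 0 ≤ C ∧ ∀ x, |g x| * ‖x - q‖ ^ 2 ≤ ε * ‖x - q‖ ^ 2 + C * φ x := by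
  obtain ⟨c, hc, δ, hδ, hb⟩ := h.symm.exists_sq_le
  obtain ⟨M, hM⟩ := isCompact_univ.bddAbove_image (f := fun x => |g x|)
    g.continuous.abs.continuousOn
  have hM' : ∀ x, |g x| ≤ M := fun x => hM ⟨x, trivial, rfl⟩
  have hM0 : 0 ≤ M := (abs_nonneg _).trans (hM' p)
  let f : C(Torus2, ℝ) := ⟨fun x => |g x| * ‖x - q‖ ^ 2, by fun_prop⟩
  have hK : IsCompact {x | ε ≤ |g x| ∧ δ ≤ ‖x - q‖} :=
    ((isClosed_le continuous_const g.continuous.abs).inter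
      (isClosed_le continuous_const
        (show Continuous fun x : Torus2 => ‖x - q‖ by fun_prop))).isCompact
  have hpos : ∀ x ∈ {x | ε ≤ |g x| ∧ δ ≤ ‖x - q‖}, 0 < φ x := by
    intro x hx
    refine h.pos ?_ ?_ <;> rintro rfl
    · have := hx.1; simp [hp] at this; linarith
    · have := hx.2; simp at this; linarith
  obtain ⟨C, hC⟩ := hK.bddAbove_image (f := fun x => f x / φ x)
    (f.continuous.continuousOn.div h.continuous.continuousOn fun x hx => (hpos x hx).ne')
  -- `M / c` serves near `q`, by non-degeneracy, and `C` on the compact set away from `q` where `ε ≤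
  -- |g|`; elsewhere the `ε` term suffices.
  refine ⟨max C (M / c), (by positivity : 0 ≤ M / c).trans (le_max_right _ _), fun x => ?_⟩
  have hφ := h.nonneg x
  have hC1 : C * φ x ≤ max C (M / c) * φ x := by gcongr; exact le_max_left _ _
  have hC2 : M / c * φ x ≤ max C (M / c) * φ x := by gcongr; exact le_max_right _ _
  have h3 : 0 ≤ M / c * φ x := by positivity
  have h4 : 0 ≤ ε * ‖x - q‖ ^ 2 := by positivity
  rcases lt_or_ge |g x| ε with hx | hx
  · have : |g x| * ‖x - q‖ ^ 2 ≤ ε * ‖x - q‖ ^ 2 := by gcongr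
    linarith
  rcases lt_or_ge ‖x - q‖ δ with hx' | hx'
  · have h1 := hb x hx'
    have h2 : |g x| * ‖x - q‖ ^ 2 ≤ M / c * φ x := by
      calc |g x| * ‖x - q‖ ^ 2 ≤ M * ‖x - q‖ ^ 2 := by gcongr; exact hM' x
        _ = M / c * (c * ‖x - q‖ ^ 2) := by field_simp
        _ ≤ _ := by gcongr
    linarith
  · have h1 : f x / φ x ≤ C := hC ⟨x, ⟨hx, hx'⟩, rfl⟩
    rw [div_le_iff₀ (hpos x ⟨hx, hx'⟩)] at h1
    have h2 : f x = |g x| * ‖x - q‖ ^ 2 := rfl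
    linarith

end Local

/-! ### Completeness of bounded Lipschitz vector fields -/

section GlobalFlow

variable {E : Type*} [NormedAddCommGroup E]

/-- A speed bound `M` confines solutions to radius `M * n + r` up to time `n`, so the time interval
can be arbitrarily long. -/
lemma isPicardLindelof_of_bounded {V : E → E} {K M : NNReal} (hK : LipschitzWith K V)
    (hM : ∀ x, ‖V x‖ ≤ M) (x₀ : E) (r : NNReal) (n : ℕ) :
    IsPicardLindelof (fun _ => V) (tmin := -(n : ℝ)) (tmax := n) ⟨0, by simp⟩ x₀
      (M * n + r) r M K :=
  IsPicardLindelof.of_time_independent (fun x _ => hM x) hK.lipschitzOnWith (by simp)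

variable [NormedSpace ℝ E]

lemma eqOn_of_hasDerivWithinAt {V : E → E} {K : NNReal} (hK : LipschitzWith K V) {f g : ℝ → E}
    {T : ℝ} (hT : 0 < T)
    (hf : ∀ t ∈ Set.Icc (-T) T, HasDerivWithinAt f (V (f t)) (Set.Icc (-T) T) t)
    (hg : ∀ t ∈ Set.Icc (-T) T, HasDerivWithinAt g (V (g t)) (Set.Icc (-T) T) t)
    (h0 : f 0 = g 0) : Set.EqOn f g (Set.Icc (-T) T) :=
  ODE_solution_unique_of_mem_Icc (v := fun _ => V) (s := fun _ => Set.univ) (t₀ := 0)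
    (fun _ _ => hK.lipschitzOnWith) ⟨by linarith, hT⟩
    (fun t ht => (hf t ht).continuousWithinAt)
    (fun t ht => (hf t (Set.Ioo_subset_Icc_self ht)).hasDerivAt (Icc_mem_nhds ht.1 ht.2))
    (fun _ _ => trivial)
    (fun t ht => (hg t ht).continuousWithinAt)
    (fun t ht => (hg t (Set.Ioo_subset_Icc_self ht)).hasDerivAt (Icc_mem_nhds ht.1 ht.2))
    (fun _ _ => trivial) h0

lemma hasDerivAt_unique {V : E → E} {K : NNReal} (hK : LipschitzWith K V) {f g : ℝ → E}
    (hf : ∀ t, HasDerivAt f (V (f t)) t) (hg : ∀ t, HasDerivAt g (V (g t)) t)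
    (h0 : f 0 = g 0) : f = g :=
  ODE_solution_unique_univ (v := fun _ => V) (s := fun _ => Set.univ) (t₀ := 0)
    (fun _ => hK.lipschitzOnWith) (fun t => ⟨hf t, trivial⟩) (fun t => ⟨hg t, trivial⟩) h0

variable [CompleteSpace E]

lemma exists_global_solution {V : E → E} {K M : NNReal} (hK : LipschitzWith K V)
    (hM : ∀ x, ‖V x‖ ≤ M) (x : E) :
    ∃ γ : ℝ → E, γ 0 = x ∧ ∀ t, HasDerivAt γ (V (γ t)) t := by
  have hex : ∀ n : ℕ, ∃ α : ℝ → E, α 0 = x ∧ ∀ t ∈ Set.Icc (-(n : ℝ)) n,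
      HasDerivWithinAt α (V (α t)) (Set.Icc (-(n : ℝ)) n) t := fun n =>
    (isPicardLindelof_of_bounded hK hM x 0 n).exists_eq_forall_mem_Icc_hasDerivWithinAt₀
  choose α hα0 hα using hex
  have hsub : ∀ {m n : ℕ}, m ≤ n → Set.Icc (-(m : ℝ)) m ⊆ Set.Icc (-(n : ℝ)) n := by
    intro m n hmn
    have : (m : ℝ) ≤ n := by exact_mod_cast hmn
    exact Set.Icc_subset_Icc (by linarith) this
  have hagree : ∀ {m n : ℕ}, 0 < m → m ≤ n → Set.EqOn (α m) (α n) (Set.Icc (-(m : ℝ)) m) :=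
    fun {m n} hm hmn => eqOn_of_hasDerivWithinAt hK (by exact_mod_cast hm) (hα m)
      (fun t ht => (hα n t (hsub hmn ht)).mono (hsub hmn)) (by rw [hα0, hα0])
  have hmem : ∀ t : ℝ, t ∈ Set.Icc (-((⌈|t|⌉₊ + 1 : ℕ) : ℝ)) ((⌈|t|⌉₊ + 1 : ℕ) : ℝ) := by
    intro t
    rw [Set.mem_Icc, ← abs_le]
    push_cast
    linarith [Nat.le_ceil |t|]
  have hγ : ∀ (n : ℕ), 0 < n → ∀ t ∈ Set.Icc (-(n : ℝ)) n, α (⌈|t|⌉₊ + 1) t = α n t := by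
    intro n hn t ht
    rcases le_total (⌈|t|⌉₊ + 1) n with h | h
    · exact hagree (Nat.succ_pos _) h (hmem t)
    · exact (hagree hn h ht).symm
  refine ⟨fun t => α (⌈|t|⌉₊ + 1) t, hα0 _, fun t => ?_⟩
  -- The `+ 1` puts `t` in the interior of its interval, so the patched curve agrees with a single
  -- solution near `t`.
  have ht : |t| < (⌈|t|⌉₊ + 1 : ℕ) := by
    push_cast
    linarith [Nat.le_ceil |t|]
  have hnhds := Icc_mem_nhds (abs_lt.1 ht).1 (abs_lt.1 ht).2
  refine ((hα _ t (hmem t)).hasDerivAt hnhds).congr_of_eventuallyEq ?_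
  filter_upwards [hnhds] with s hs
  exact hγ _ (Nat.succ_pos _) s hs

/-- A bounded Lipschitz vector field on a Banach space is complete and has a continuous flow. -/
lemma exists_global_flow {V : E → E} {K M : NNReal} (hK : LipschitzWith K V)
    (hM : ∀ x, ‖V x‖ ≤ M) :
    ∃ Φ : E → ℝ → E, (∀ x, Φ x 0 = x) ∧ (∀ x t, HasDerivAt (Φ x) (V (Φ x t)) t) ∧
      Continuous fun z : E × ℝ => Φ z.1 z.2 := by
  choose Φ hΦ0 hΦ using exists_global_solution hK hM
  refine ⟨Φ, hΦ0, hΦ, continuous_iff_continuousAt.2 fun ⟨x, t⟩ => ?_⟩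
  obtain ⟨n, hn⟩ := exists_nat_gt |t|
  have hn0 : (0 : ℝ) < n := (abs_nonneg t).trans_lt hn
  obtain ⟨α, hα, hαc⟩ := (isPicardLindelof_of_bounded hK hM x 1
    n).exists_forall_mem_closedBall_eq_hasDerivWithinAt_continuousOn
  have heq : Set.EqOn (fun z : E × ℝ => Φ z.1 z.2) α
      (Metric.closedBall x (1 : NNReal) ×ˢ Set.Icc (-(n : ℝ)) n) := by
    rintro ⟨y, s⟩ ⟨hy, hs⟩
    exact eqOn_of_hasDerivWithinAt hK hn0 (fun t _ => (hΦ y t).hasDerivWithinAt) (hα y hy).2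
      ((hΦ0 y).trans (hα y hy).1.symm) hs
  refine (hαc.congr heq).continuousAt (prod_mem_nhds (Metric.closedBall_mem_nhds x one_pos) ?_)
  exact Icc_mem_nhds (abs_lt.1 hn).1 (abs_lt.1 hn).2

end GlobalFlow

/-! ### The flow on the torus and its orbits -/

section Flow

variable {φ : Torus2 → ℝ} {p q : Torus2}

lemma IsStoppingFunction.exists_lipschitz_field (h : IsStoppingFunction φ p q) (a : ℝ) :
    ∃ K M : NNReal, LipschitzWith K (fun w : ℝ × ℝ => φ (proj w) • ((1 : ℝ), a)) ∧
      ∀ w : ℝ × ℝ, ‖φ (proj w) • ((1 : ℝ), a)‖ ≤ M := by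
  obtain ⟨K, hK⟩ := h.exists_lipschitz
  obtain ⟨M, hM, hM'⟩ := h.exists_le
  refine ⟨K * ‖((1 : ℝ), a)‖₊, ⟨M, hM.le⟩ * ‖((1 : ℝ), a)‖₊, ?_, ?_⟩
  · refine LipschitzWith.of_dist_le_mul fun v w => ?_
    rw [dist_eq_norm, ← sub_smul, norm_smul]
    have := hK.dist_le_mul v w
    rw [dist_eq_norm] at this
    calc _ ≤ (K * dist v w) * ‖((1 : ℝ), a)‖ := by gcongr
      _ = _ := by push_cast; ring
  · intro w
    rw [norm_smul, Real.norm_of_nonneg (h.nonneg _)]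
    exact mul_le_mul_of_nonneg_right (hM' _) (norm_nonneg _)

/-- The vector field `φ · (1, a)` generates a flow on the torus. -/
lemma IsStoppingFunction.exists_flow (h : IsStoppingFunction φ p q) (a : ℝ) :
    ∃ T : Flow ℝ Torus2, IsGeneratedBy T φ a := by
  obtain ⟨K, M, hK, hM⟩ := h.exists_lipschitz_field a
  obtain ⟨Φ, hΦ0, hΦ, hΦc⟩ := exists_global_flow hK hM
  -- By uniqueness the lifted flow commutes with integer translations, hence descends to the torus.
  have hper : ∀ v w, proj v = proj w → ∀ t, proj (Φ v t) = proj (Φ w t) := by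
    intro v w hvw t
    obtain ⟨m, n, rfl⟩ := exists_int_of_proj_eq hvw
    have : Φ (w + ((m : ℝ), (n : ℝ))) = fun t => Φ w t + ((m : ℝ), (n : ℝ)) := by
      refine hasDerivAt_unique hK (hΦ _) (fun t => ?_) (by simp [hΦ0])
      have := (hΦ w t).add_const ((m : ℝ), (n : ℝ))
      simpa [proj_add, proj_int] using this
    simp [this, proj_add, proj_int]
  choose ℓ hℓ using proj_surjective
  have hT : ∀ t v, proj (Φ (ℓ (proj v)) t) = proj (Φ v t) := fun t v => hper _ _ (hℓ _) t
  refine ⟨⟨fun t x => proj (Φ (ℓ x) t), ?_, ?_, ?_⟩, ?_⟩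
  · have hq : IsOpenQuotientMap (Prod.map id proj : ℝ × (ℝ × ℝ) → ℝ × Torus2) :=
      IsOpenQuotientMap.id.prodMap isOpenQuotientMap_proj
    refine hq.isQuotientMap.continuous_iff.2 ?_
    have : (Function.uncurry fun t x => proj (Φ (ℓ x) t)) ∘ Prod.map id proj =
        fun z : ℝ × (ℝ × ℝ) => proj (Φ z.2 z.1) := by
      funext z
      exact hT z.1 z.2
    rw [this]
    exact continuous_proj.comp (hΦc.comp continuous_swap)
  · intro s t x
    rw [hT]
    congr 1
    have : (fun s => Φ (ℓ x) (s + t)) = Φ (Φ (ℓ x) t) :=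
      hasDerivAt_unique hK (fun s => (hΦ (ℓ x) (s + t)).comp_add_const s t) (hΦ _)
        (by simp [hΦ0])
    exact congrFun this s
  · intro x
    rw [hΦ0, hℓ]
  · intro x
    exact ⟨Φ (ℓ x), fun t => rfl, fun t => hΦ _ t⟩

/-- Every orbit stays on a line of direction `(1, a)`. -/
lemma IsGeneratedBy.exists_param {T : Flow ℝ Torus2} {a : ℝ} (hT : IsGeneratedBy T φ a)
    (x : Torus2) : ∃ θ : ℝ → ℝ, θ 0 = 0 ∧ (∀ t, T t x = x + line a (θ t)) ∧
      ∀ t, HasDerivAt θ (φ (x + line a (θ t))) t := by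
  obtain ⟨γ, hγ, hγ'⟩ := hT x
  have h1 : ∀ t, HasDerivAt (fun t => (γ t).1) (φ (proj (γ t))) t := fun t =>
    (hasFDerivAt_fst.comp_hasDerivAt t (hγ' t)).congr_deriv (by simp)
  have h2 : ∀ t, HasDerivAt (fun t => (γ t).2) (φ (proj (γ t)) * a) t := fun t =>
    (hasFDerivAt_snd.comp_hasDerivAt t (hγ' t)).congr_deriv (by simp)
  have h3 : ∀ t, (γ t).2 - a * (γ t).1 = (γ 0).2 - a * (γ 0).1 := by
    intro t
    refine is_const_of_deriv_eq_zero (f := fun t => (γ t).2 - a * (γ t).1)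
      (fun t => ((h2 t).sub ((h1 t).const_mul a)).differentiableAt) (fun t => ?_) t 0
    have := ((h2 t).sub ((h1 t).const_mul a)).deriv
    refine this.trans (by ring)
  have h4 : ∀ t, proj (γ t) = x + line a ((γ t).1 - (γ 0).1) := by
    intro t
    have hx : x = proj (γ 0) := by rw [← hγ, T.map_zero_apply]
    rw [hx, line_eq_proj, ← proj_add]
    congr 1
    ext
    · simp
    · have := h3 t
      simp
      linarith
  refine ⟨fun t => (γ t).1 - (γ 0).1, by simp, fun t => by rw [hγ, h4], fun t => ?_⟩
  rw [← h4]
  exact (h1 t).sub_const _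

/-- The constant curve at a lift of `p` is also an integral curve, so uniqueness applies. -/
lemma IsStoppingFunction.map_left (h : IsStoppingFunction φ p q) {T : Flow ℝ Torus2} {a : ℝ}
    (hT : IsGeneratedBy T φ a) (t : ℝ) : T t p = p := by
  obtain ⟨K, M, hK, hM⟩ := h.exists_lipschitz_field a
  obtain ⟨γ, hγ, hγ'⟩ := hT p
  have h0 : proj (γ 0) = p := by rw [← hγ, T.map_zero_apply]
  have : γ = fun _ => γ 0 := by
    refine hasDerivAt_unique hK hγ' (fun t => ?_) rfl
    rw [h0, h.left_eq_zero, zero_smul]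
    exact hasDerivAt_const t _
  rw [hγ, this, h0]

end Flow

/-! ### Weyl equidistribution -/

section Weyl

open UnitAddTorus

/-- The exponential monomial `mFourier n`, as a function on `𝕋²` regarded as a product. -/
def character (n : Fin 2 → ℤ) (x : Torus2) : ℂ := mFourier n ![x.1, x.2]

lemma character_apply (n : Fin 2 → ℤ) (x : Torus2) :
    character n x = fourier (n 0) x.1 * fourier (n 1) x.2 := by
  simp [character, mFourier, Fin.prod_univ_two]

lemma character_add_line (n : Fin 2 → ℤ) (x : Torus2) (a σ : ℝ) :
    character n (x + line a σ) =
      character n x * Complex.exp ((2 * Real.pi * (n 0 + n 1 * a) : ℝ) * Complex.I * σ) := by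
  obtain ⟨X, rfl⟩ := proj_surjective x
  have h : proj X + line a σ = proj (X + σ • ((1 : ℝ), a)) := by rw [line_eq_proj, proj_add]
  rw [h, character_apply, character_apply]
  simp only [proj, fourier_coe_apply, ← Complex.exp_add]
  congr 1
  simp
  ring

lemma frequency_ne_zero {a : ℝ} (ha : Irrational a) {n : Fin 2 → ℤ} (hn : n ≠ 0) :
    2 * Real.pi * (n 0 + n 1 * a) ≠ 0 := by
  have hpi := Real.pi_pos.ne'
  refine mul_ne_zero (by positivity) fun h => hn ?_
  have h1 : n 1 = 0 := by
    by_contra h1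
    have := (ha.intCast_mul h1).intCast_add (n 0)
    exact this.ne_zero h
  have h0 : n 0 = 0 := by simpa [h1] using h
  funext i
  fin_cases i
  · exact h0
  · exact h1

instance : IsProbabilityMeasure (volume : Measure UnitAddCircle) :=
  ⟨UnitAddCircle.measure_univ⟩

instance : Measure.IsAddHaarMeasure (volume : Measure Torus2) :=
  inferInstanceAs (Measure.IsAddHaarMeasure
    ((volume : Measure UnitAddCircle).prod (volume : Measure UnitAddCircle)))

/-- Translation preserves the integral, and a suitable translation changes the sign of the
character. The slope `√2` is just one irrational choice, making the frequency `κ` non-zero. -/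
lemma integral_character_eq_zero {n : Fin 2 → ℤ} (hn : n ≠ 0) : ∫ x, character n x = 0 := by
  have ha := irrational_sqrt_two
  set κ := 2 * Real.pi * (n 0 + n 1 * √2) with hκ
  have hκ0 : κ ≠ 0 := frequency_ne_zero ha hn
  have h1 : ∫ x, character n (x + line (√2) (Real.pi / κ)) = ∫ x, character n x :=
    integral_add_right_eq_self _ _
  have h2 : Complex.exp ((κ : ℂ) * Complex.I * (Real.pi / κ : ℝ)) = -1 := by
    rw [← Complex.exp_pi_mul_I]
    congr 1
    have : (κ : ℂ) ≠ 0 := by exact_mod_cast hκ0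
    push_cast
    field_simp
  simp_rw [character_add_line, ← hκ, h2] at h1
  rw [integral_mul_const] at h1
  linear_combination -(1 / 2 : ℂ) * h1

/-- Averages of characters along an irrational line converge to their integral. -/
lemma tendsto_average_character {a : ℝ} (ha : Irrational a) (x : Torus2) (n : Fin 2 → ℤ) :
    Tendsto (fun s : ℝ => (s : ℂ)⁻¹ * ∫ σ in (0 : ℝ)..s, character n (x + line a σ)) atTop
      (𝓝 (∫ y, character n y)) := by
  rcases eq_or_ne n 0 with rfl | hn
  · have h1 : ∀ y, character 0 y = 1 := fun y => by simp [character_apply]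
    simp only [h1]
    refine tendsto_const_nhds.congr' ?_
    filter_upwards [eventually_gt_atTop 0] with s hs
    have : (s : ℂ) ≠ 0 := by exact_mod_cast hs.ne'
    simp [this]
  · rw [integral_character_eq_zero hn]
    set κ := 2 * Real.pi * (n 0 + n 1 * a) with hκ
    have hκ0 : (κ : ℂ) * Complex.I ≠ 0 :=
      mul_ne_zero (by exact_mod_cast frequency_ne_zero ha hn) Complex.I_ne_zero
    simp_rw [character_add_line, ← hκ, intervalIntegral.integral_const_mul,
      integral_exp_mul_complex hκ0]
    rw [tendsto_zero_iff_norm_tendsto_zero]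
    have hlim : Tendsto (fun s : ℝ => s⁻¹ * (‖character n x‖ * (2 / ‖(κ : ℂ) * Complex.I‖)))
        atTop (𝓝 0) := by
      simpa using tendsto_inv_atTop_zero.mul_const (‖character n x‖ * (2 / ‖(κ : ℂ) * Complex.I‖))
    refine squeeze_zero' (Eventually.of_forall fun _ => norm_nonneg _) ?_ hlim
    filter_upwards [eventually_gt_atTop 0] with s hs
    rw [norm_mul, norm_mul, norm_inv, Complex.norm_real, Real.norm_of_nonneg hs.le, norm_div]
    gcongr
    refine (norm_sub_le _ _).trans ?_
    have e : ∀ r : ℝ, ‖Complex.exp ((κ : ℂ) * Complex.I * r)‖ = 1 := by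
      intro r
      rw [show (κ : ℂ) * Complex.I * r = ((κ * r : ℝ) : ℂ) * Complex.I by push_cast; ring,
        Complex.norm_exp_ofReal_mul_I]
    rw [e, e]
    norm_num

/-- The comparison of the two models of the torus. -/
def torusHomeo : Torus2 ≃ₜ UnitAddTorus (Fin 2) :=
  (Homeomorph.piFinTwo fun _ : Fin 2 => UnitAddCircle).symm

lemma torusHomeo_apply (x : Torus2) : torusHomeo x = ![x.1, x.2] := by
  ext i
  fin_cases i <;> rfl

lemma tendsto_average_span {a : ℝ} (ha : Irrational a) (x : Torus2)
    (G : C(UnitAddTorus (Fin 2), ℂ))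
    (hG : G ∈ Submodule.span ℂ (Set.range (mFourier (d := Fin 2)))) :
    Tendsto (fun s : ℝ => (s : ℂ)⁻¹ * ∫ σ in (0 : ℝ)..s, G (torusHomeo (x + line a σ))) atTop
      (𝓝 (∫ y, G (torusHomeo y))) := by
  have hint : ∀ (F : C(UnitAddTorus (Fin 2), ℂ)),
      Integrable (fun y : Torus2 => F (torusHomeo y)) volume := fun F =>
    (F.continuous.comp torusHomeo.continuous).integrable_of_hasCompactSupport
      (HasCompactSupport.of_compactSpace _)
  have hint' : ∀ (F : C(UnitAddTorus (Fin 2), ℂ)) (s : ℝ),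
      IntervalIntegrable (fun σ => F (torusHomeo (x + line a σ))) volume 0 s := fun F s =>
    (F.continuous.comp (torusHomeo.continuous.comp
      (continuous_const.add (continuous_line a)))).intervalIntegrable _ _
  induction hG using Submodule.span_induction with
  | mem F hF =>
    obtain ⟨n, rfl⟩ := hF
    simpa [torusHomeo_apply, character] using tendsto_average_character ha x n
  | zero => simp
  | add F H _ _ hF hH =>
    have := hF.add hH
    simp only [ContinuousMap.add_apply]
    rw [integral_add (hint F) (hint H)]
    refine this.congr fun s => ?_
    rw [intervalIntegral.integral_add (hint' F s) (hint' H s), mul_add]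
  | smul c F _ hF =>
    have := hF.const_mul c
    simp only [ContinuousMap.smul_apply, smul_eq_mul]
    rw [integral_const_mul]
    refine this.congr fun s => ?_
    rw [intervalIntegral.integral_const_mul]
    ring

/-- **Weyl equidistribution** of lines with irrational slope on the two-torus. -/
theorem tendsto_average {a : ℝ} (ha : Irrational a) (x : Torus2) (G : C(Torus2, ℝ)) :
    Tendsto (fun s : ℝ => s⁻¹ * ∫ σ in (0 : ℝ)..s, G (x + line a σ)) atTop
      (𝓝 (∫ y, G y)) := by
  let G' : C(UnitAddTorus (Fin 2), ℂ) :=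
    ⟨fun z => ((G (torusHomeo.symm z) : ℝ) : ℂ), by fun_prop⟩
  have hG' : ∀ y, G' (torusHomeo y) = (G y : ℂ) := fun y => by simp [G']
  rw [Metric.tendsto_atTop]
  intro ε hε
  have hmem : G' ∈ closure (Submodule.span ℂ (Set.range (mFourier (d := Fin 2))) : Set _) := by
    have := span_mFourier_closure_eq_top (d := Fin 2)
    rw [← Submodule.topologicalClosure_coe, this]
    trivial
  obtain ⟨H, hH, hd⟩ := Metric.mem_closure_iff.1 hmem (ε / 3) (by positivity)
  have hpt : ∀ y, ‖(G y : ℂ) - H (torusHomeo y)‖ ≤ ε / 3 := fun y => by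
    rw [← hG', ← dist_eq_norm]
    exact (ContinuousMap.dist_apply_le_dist _).trans hd.le
  obtain ⟨S, hS⟩ := Metric.tendsto_atTop.1 (tendsto_average_span ha x H hH) (ε / 3) (by positivity)
  refine ⟨max S 1, fun s hs => ?_⟩
  have hs0 : 0 < s := by linarith [le_max_right S 1]
  have h1 := hS s ((le_max_left _ _).trans hs)
  rw [dist_eq_norm] at h1
  have hGi : Integrable (fun y : Torus2 => (G y : ℂ)) volume :=
    (Complex.continuous_ofReal.comp G.continuous).integrable_of_hasCompactSupport
      (HasCompactSupport.of_compactSpace _)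
  have hHi : Integrable (fun y : Torus2 => H (torusHomeo y)) volume :=
    (H.continuous.comp torusHomeo.continuous).integrable_of_hasCompactSupport
      (HasCompactSupport.of_compactSpace _)
  have hl : Continuous fun σ => x + line a σ := continuous_const.add (continuous_line a)
  have hGl : Continuous fun σ => (G (x + line a σ) : ℂ) :=
    Complex.continuous_ofReal.comp (G.continuous.comp hl)
  have hHl : Continuous fun σ => H (torusHomeo (x + line a σ)) :=
    H.continuous.comp (torusHomeo.continuous.comp hl)
  have h2 : ‖(∫ y, (G y : ℂ)) - ∫ y, H (torusHomeo y)‖ ≤ ε / 3 := by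
    rw [← integral_sub hGi hHi]
    simpa using norm_integral_le_of_norm_le_const (μ := (volume : Measure Torus2))
      (Eventually.of_forall hpt)
  have h3 : ‖(s : ℂ)⁻¹ * (∫ σ in (0 : ℝ)..s, (G (x + line a σ) : ℂ)) -
      (s : ℂ)⁻¹ * ∫ σ in (0 : ℝ)..s, H (torusHomeo (x + line a σ))‖ ≤ ε / 3 := by
    rw [← mul_sub, ← intervalIntegral.integral_sub (hGl.intervalIntegrable _ _)
      (hHl.intervalIntegrable _ _), norm_mul, norm_inv, Complex.norm_real,
      Real.norm_of_nonneg hs0.le, inv_mul_le_iff₀ hs0]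
    have := intervalIntegral.norm_integral_le_of_norm_le_const (a := 0) (b := s) (C := ε / 3)
      (f := fun σ => (G (x + line a σ) : ℂ) - H (torusHomeo (x + line a σ)))
      fun σ _ => hpt _
    rw [sub_zero, abs_of_pos hs0] at this
    linarith
  have h4 : ‖(s : ℂ)⁻¹ * (∫ σ in (0 : ℝ)..s, (G (x + line a σ) : ℂ)) - ∫ y, (G y : ℂ)‖ < ε := by
    set A := (s : ℂ)⁻¹ * (∫ σ in (0 : ℝ)..s, (G (x + line a σ) : ℂ))
    set B := (s : ℂ)⁻¹ * ∫ σ in (0 : ℝ)..s, H (torusHomeo (x + line a σ))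
    set C := ∫ y, H (torusHomeo y)
    set D := ∫ y, (G y : ℂ)
    rw [norm_sub_rev] at h2
    calc ‖A - D‖ = ‖(A - B) + (B - C) + (C - D)‖ := by congr 1; ring
      _ ≤ ‖A - B‖ + ‖B - C‖ + ‖C - D‖ := norm_add₃_le
      _ < ε := by linarith
  rw [intervalIntegral.integral_ofReal, integral_complex_ofReal, ← Complex.ofReal_inv,
    ← Complex.ofReal_mul, ← Complex.ofReal_sub, Complex.norm_real] at h4
  rw [dist_eq_norm]
  exact h4

end Weyl

/-! ### Non-integrability of `1 / φ` -/

section Divergence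

variable {φ : Torus2 → ℝ} {p q : Torus2}

/-- The sum is a dyadic minorant of `1 / (r ^ 2 + 4⁻¹ ^ J)`, being geometric down to the scale of
`r`. On the two-torus each of its `J` layers has integral one, which produces the divergence. -/
lemma dyadic_sum_le (r : ℝ) (hr : 0 ≤ r) (J : ℕ) :
    (r ^ 2 + (4⁻¹ : ℝ) ^ J) *
      ∑ j ∈ Finset.range J, (4 : ℝ) ^ j * (if r ≤ 2⁻¹ ^ (j + 1) then 1 else 0) ≤ 1 := by
  induction J with
  | zero => simp
  | succ J ih =>
    have e4 : (4⁻¹ : ℝ) ^ (J + 1) = (2⁻¹ ^ (J + 1)) ^ 2 := by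
      rw [← pow_mul, mul_comm, pow_mul]
      norm_num
    by_cases h : r ≤ 2⁻¹ ^ (J + 1)
    · have h1 : ∑ j ∈ Finset.range (J + 1), (4 : ℝ) ^ j * (if r ≤ 2⁻¹ ^ (j + 1) then 1 else 0)
          ≤ ∑ j ∈ Finset.range (J + 1), (4 : ℝ) ^ j := by
        refine Finset.sum_le_sum fun j _ => mul_le_of_le_one_right (by positivity) ?_
        split_ifs <;> norm_num
      rw [geom_sum_eq (by norm_num)] at h1
      have h2 : r ^ 2 ≤ (4⁻¹ : ℝ) ^ (J + 1) := by
        rw [e4]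
        gcongr
      have h3 : (4⁻¹ : ℝ) ^ (J + 1) * 4 ^ (J + 1) = 1 := by
        rw [← mul_pow]
        norm_num
      have h4 : 0 < (4⁻¹ : ℝ) ^ (J + 1) := by positivity
      calc _ ≤ (2 * (4⁻¹ : ℝ) ^ (J + 1)) * ((4 ^ (J + 1) - 1) / (4 - 1)) := by
            gcongr
            linarith
        _ ≤ 1 := by nlinarith
    · rw [Finset.sum_range_succ, if_neg h, mul_zero, add_zero]
      refine le_trans ?_ ih
      refine mul_le_mul_of_nonneg_right ?_ (Finset.sum_nonneg fun j _ => ?_)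
      · rw [pow_succ _ J]
        have : (0 : ℝ) < 4⁻¹ ^ J := by positivity
        linarith
      · split_ifs <;> positivity

lemma volume_real_closedBall_torus (x : Torus2) (j : ℕ) :
    volume.real (Metric.closedBall x ((2⁻¹ : ℝ) ^ (j + 1))) = (4⁻¹ : ℝ) ^ j := by
  have h1 : ∀ y : UnitAddCircle, volume.real (Metric.closedBall y ((2⁻¹ : ℝ) ^ (j + 1))) =
      2⁻¹ ^ j := by
    intro y
    have : 2 * (2⁻¹ : ℝ) ^ (j + 1) = 2⁻¹ ^ j := by rw [pow_succ]; ring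
    rw [Measure.real, AddCircle.volume_closedBall, this, min_eq_right, ENNReal.toReal_ofReal]
    · positivity
    · exact pow_le_one₀ (by norm_num) (by norm_num)
  rw [← closedBall_prod_same, Measure.volume_eq_prod, measureReal_prod_prod, h1, h1, ← mul_pow]
  norm_num

lemma integrable_of_continuous {f : Torus2 → ℝ} (hf : Continuous f) (ν : Measure Torus2)
    [IsFiniteMeasure ν] : Integrable f ν :=
  hf.integrable_of_hasCompactSupport (HasCompactSupport.of_compactSpace _)

lemma continuous_inv_add (h : IsStoppingFunction φ p q) {η : ℝ} (hη : 0 < η) :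
    Continuous fun x => (φ x + η)⁻¹ :=
  (h.continuous.add continuous_const).inv₀ fun x =>
    (add_pos_of_nonneg_of_pos (h.nonneg x) hη).ne'

/-- The function `1 / φ` is not integrable. -/
lemma IsStoppingFunction.exists_integral_ge (h : IsStoppingFunction φ p q) (B : ℝ) :
    ∃ η > 0, B ≤ ∫ x, (φ x + η)⁻¹ := by
  obtain ⟨C, hC, hC'⟩ := h.exists_le_sq
  -- The integral will be at least `J / max C 1`; the `1` in the maximum absorbs the regularization
  -- `η = 4⁻¹ ^ J`.
  obtain ⟨J, hJ⟩ := exists_nat_ge (B * max C 1)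
  have hC1 : 0 < max C 1 := by positivity
  refine ⟨(4⁻¹ : ℝ) ^ J, by positivity, ?_⟩
  set S : Torus2 → ℝ := fun x => ∑ j ∈ Finset.range J,
    (Metric.closedBall p ((2⁻¹ : ℝ) ^ (j + 1))).indicator (fun _ => (4 : ℝ) ^ j) x with hS
  have hSint : ∀ j ∈ Finset.range J, Integrable
      ((Metric.closedBall p ((2⁻¹ : ℝ) ^ (j + 1))).indicator fun _ => (4 : ℝ) ^ j)
      (volume : Measure Torus2) := fun j _ =>
    (integrable_const _).indicator Metric.isClosed_closedBall.measurableSet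
  have hSI : ∫ x, S x = J := by
    rw [hS, integral_finsetSum _ hSint]
    have : ∀ j ∈ Finset.range J, ∫ x : Torus2,
        (Metric.closedBall p ((2⁻¹ : ℝ) ^ (j + 1))).indicator (fun _ => (4 : ℝ) ^ j) x = 1 := by
      intro j _
      rw [integral_indicator_const _ Metric.isClosed_closedBall.measurableSet,
        volume_real_closedBall_torus, smul_eq_mul, ← mul_pow]
      norm_num
    rw [Finset.sum_congr rfl this]
    simp
  have hle : ∀ x, (max C 1)⁻¹ * S x ≤ (φ x + (4⁻¹ : ℝ) ^ J)⁻¹ := by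
    intro x
    have h1 := dyadic_sum_le ‖x - p‖ (norm_nonneg _) J
    have h2 : S x = ∑ j ∈ Finset.range J, (4 : ℝ) ^ j *
        (if ‖x - p‖ ≤ 2⁻¹ ^ (j + 1) then 1 else 0) := by
      refine Finset.sum_congr rfl fun j _ => ?_
      classical
      rw [Set.indicator_apply, Metric.mem_closedBall, dist_eq_norm, mul_ite, mul_one, mul_zero]
    rw [← h2] at h1
    have hS0 : 0 ≤ S x := Finset.sum_nonneg fun j _ =>
      Set.indicator_nonneg (fun _ _ => by positivity) _
    have h4 : 0 < (4⁻¹ : ℝ) ^ J := by positivity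
    have h5 := h.nonneg x
    rw [inv_mul_le_iff₀ hC1, ← div_eq_mul_inv, le_div_iff₀ (by positivity)]
    have h6 : φ x + (4⁻¹ : ℝ) ^ J ≤ max C 1 * (‖x - p‖ ^ 2 + (4⁻¹ : ℝ) ^ J) := by
      have e1 : C * ‖x - p‖ ^ 2 ≤ max C 1 * ‖x - p‖ ^ 2 := by gcongr; exact le_max_left _ _
      have e2 : 1 * (4⁻¹ : ℝ) ^ J ≤ max C 1 * (4⁻¹ : ℝ) ^ J := by gcongr; exact le_max_right _ _
      linarith [hC' x]
    calc S x * (φ x + (4⁻¹ : ℝ) ^ J) ≤ S x * (max C 1 * (‖x - p‖ ^ 2 + (4⁻¹ : ℝ) ^ J)) := by gcongr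
      _ = max C 1 * ((‖x - p‖ ^ 2 + (4⁻¹ : ℝ) ^ J) * S x) := by ring
      _ ≤ max C 1 * 1 := by gcongr
      _ = max C 1 := mul_one _
  have := integral_mono ((integrable_finsetSum _ hSint).const_mul (max C 1)⁻¹)
    (integrable_of_continuous (continuous_inv_add h (by positivity)) volume) hle
  rw [integral_const_mul, hSI] at this
  refine le_trans ?_ this
  rw [le_inv_mul_iff₀ hC1]
  linarith

end Divergence

/-! ### Zero asymptotic speed -/

section Speed

variable {φ : Torus2 → ℝ} {p q : Torus2} {T : Flow ℝ Torus2} {a : ℝ}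

/-- `θ` parametrizes the orbit of `x` under the vector field `φ · (1, a)`. -/
structure IsParam (φ : Torus2 → ℝ) (a : ℝ) (x : Torus2) (θ : ℝ → ℝ) : Prop where
  zero : θ 0 = 0
  hasDerivAt : ∀ t, HasDerivAt θ (φ (x + line a (θ t))) t

variable {x : Torus2} {θ : ℝ → ℝ}

lemma IsParam.continuous (hθ : IsParam φ a x θ) : Continuous θ :=
  continuous_iff_continuousAt.2 fun t => (hθ.hasDerivAt t).continuousAt

lemma IsParam.monotone (hθ : IsParam φ a x θ) (h : IsStoppingFunction φ p q) : Monotone θ :=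
  monotone_of_deriv_nonneg (fun t => (hθ.hasDerivAt t).differentiableAt) fun t => by
    rw [(hθ.hasDerivAt t).deriv]
    exact h.nonneg _

lemma IsParam.nonneg (hθ : IsParam φ a x θ) (h : IsStoppingFunction φ p q) {t : ℝ} (ht : 0 ≤ t) :
    0 ≤ θ t := by
  rw [← hθ.zero]
  exact hθ.monotone h ht

lemma IsParam.continuous_orbit (hθ : IsParam φ a x θ) : Continuous fun t => x + line a (θ t) :=
  continuous_const.add ((continuous_line a).comp hθ.continuous)

/-- Substitution `σ = θ s`, exchanging time for distance along the line. With `g = 1` it says that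
`θ t` is the integral of `φ` along the orbit. -/
lemma IsParam.integral_comp (hθ : IsParam φ a x θ) (h : IsStoppingFunction φ p q) (g : ℝ → ℝ)
    (t : ℝ) : ∫ s in (0 : ℝ)..t, g (θ s) * φ (x + line a (θ s)) = ∫ σ in (0 : ℝ)..θ t, g σ := by
  have := intervalIntegral.integral_comp_mul_deriv_of_deriv_nonneg (a := 0) (b := t) (f := θ)
    (f' := fun s => φ (x + line a (θ s))) (g := g) hθ.continuous.continuousOn
    (fun s _ => hθ.hasDerivAt s) (fun s _ => h.nonneg _)
  rw [hθ.zero] at this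
  exact this

/-- A lower bound for the time needed to travel along the orbit. -/
lemma IsParam.integral_inv_le (hθ : IsParam φ a x θ) (h : IsStoppingFunction φ p q) {η : ℝ}
    (hη : 0 < η) {t : ℝ} (ht : 0 ≤ t) :
    ∫ σ in (0 : ℝ)..θ t, (φ (x + line a σ) + η)⁻¹ ≤ t := by
  rw [← hθ.integral_comp h (fun σ => (φ (x + line a σ) + η)⁻¹) t]
  have hc : Continuous fun s => (φ (x + line a (θ s)) + η)⁻¹ * φ (x + line a (θ s)) :=
    ((continuous_inv_add h hη).comp hθ.continuous_orbit).mul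
      (h.continuous.comp hθ.continuous_orbit)
  have := intervalIntegral.integral_mono_on ht (hc.intervalIntegrable 0 t)
    (μ := volume) (g := fun _ => (1 : ℝ)) intervalIntegrable_const fun s _ => by
      have := h.nonneg (x + line a (θ s))
      rw [inv_mul_le_iff₀ (by positivity)]
      linarith
  simpa using this

/-- Orbits of the slowed down flow have zero asymptotic speed. -/
lemma IsParam.eventually_le (hθ : IsParam φ a x θ) (h : IsStoppingFunction φ p q)
    (ha : Irrational a) {ε : ℝ} (hε : 0 < ε) : ∀ᶠ t in atTop, θ t ≤ ε * t := by
  -- A space average strictly above `ε⁻¹` forces long displacements `θ t` to take time more than `θ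
  -- t / ε`; bounded displacements are harmless once `t` is large.
  obtain ⟨η, hη, hI⟩ := h.exists_integral_ge (ε⁻¹ + 1)
  have hW := tendsto_average ha x ⟨_, continuous_inv_add h hη⟩
  have hev := hW.eventually (lt_mem_nhds (show ε⁻¹ < ∫ x, (φ x + η)⁻¹ by linarith))
  obtain ⟨S, hS⟩ := eventually_atTop.1 hev
  filter_upwards [eventually_ge_atTop 0, eventually_ge_atTop (max S 1 / ε)] with t ht ht'
  rcases le_total (θ t) (max S 1) with hle | hle
  · rw [div_le_iff₀ hε] at ht'
    linarith
  · have h1 := hS _ ((le_max_left _ _).trans hle)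
    have h0 : 0 < θ t := by linarith [le_max_right S 1]
    rw [lt_inv_mul_iff₀ h0] at h1
    have h2 := hθ.integral_inv_le h hη ht
    have h3 : θ t * ε⁻¹ ≤ t := h1.le.trans h2
    rw [← div_eq_mul_inv, div_le_iff₀ hε] at h3
    linarith

lemma IsGeneratedBy.exists_isParam (hT : IsGeneratedBy T φ a) (x : Torus2) :
    ∃ θ, IsParam φ a x θ ∧ ∀ t, T t x = x + line a (θ t) := by
  obtain ⟨θ, h0, h1, h2⟩ := hT.exists_param x
  exact ⟨θ, ⟨h0, h2⟩, h1⟩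

lemma continuous_flow_right (T : Flow ℝ Torus2) (x : Torus2) : Continuous fun s => T s x :=
  T.continuous continuous_id continuous_const

/-- Empirical averages of functions vanishing at the fixed points tend to zero. -/
lemma IsStoppingFunction.tendsto_empirical (h : IsStoppingFunction φ p q) (ha : Irrational a)
    (hT : IsGeneratedBy T φ a) (x : Torus2) (f : C(Torus2, ℝ)) (hp : f p = 0) (hq : f q = 0) :
    Tendsto (fun t => empirical T x t f) atTop (𝓝 0) := by
  obtain ⟨θ, hθ, hθT⟩ := hT.exists_isParam x
  rw [Metric.tendsto_atTop']
  intro ε hε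
  obtain ⟨C, hC, hC'⟩ := h.exists_abs_le f hp hq (ε := ε / 3) (by positivity)
  -- This speed makes `C * θ t` at most `ε / 3 * t`; the `+ 1` covers `C = 0`.
  obtain ⟨t₀, ht₀⟩ := eventually_atTop.1
    (hθ.eventually_le h ha (ε := ε / (3 * (C + 1))) (by positivity))
  refine ⟨max t₀ 0, fun t ht => ?_⟩
  have ht0 : 0 < t := (le_max_right _ _).trans_lt ht
  have hspeed := ht₀ t ((le_max_left _ _).trans ht.le)
  have hcT := continuous_flow_right T x
  have hCφ : Continuous fun s => C * φ (T s x) := continuous_const.mul (h.continuous.comp hcT)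
  have hφI : ∫ s in (0 : ℝ)..t, φ (T s x) = θ t := by
    have := hθ.integral_comp h (fun _ => 1) t
    simpa [hθT] using this
  have h1 : ‖∫ s in (0 : ℝ)..t, f (T s x)‖ ≤ ε / 3 * t + C * θ t := by
    calc ‖∫ s in (0 : ℝ)..t, f (T s x)‖
        ≤ ∫ s in (0 : ℝ)..t, (ε / 3 + C * φ (T s x)) := by
          refine intervalIntegral.norm_integral_le_of_norm_le ht0.le
            (Eventually.of_forall fun s _ => hC' _) ?_
          exact (continuous_const.add hCφ).intervalIntegrable _ _
      _ = ε / 3 * t + C * θ t := by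
          rw [intervalIntegral.integral_add (by simp) (hCφ.intervalIntegrable _ _),
            intervalIntegral.integral_const_mul, hφI]
          simp
          ring
  rw [dist_zero_right, empirical, norm_mul, norm_inv, Real.norm_of_nonneg ht0.le,
    inv_mul_lt_iff₀ ht0]
  have h2 : C * θ t ≤ ε / 3 * t := by
    calc C * θ t ≤ C * (ε / (3 * (C + 1)) * t) := by gcongr
      _ = (C / (C + 1)) * (ε / 3 * t) := by field_simp
      _ ≤ 1 * (ε / 3 * t) := by
          gcongr
          rw [div_le_one (by positivity)]
          linarith
      _ = _ := one_mul _
  nlinarith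

end Speed

/-! ### Invariant measures and accumulation points -/

section Measures

variable {φ : Torus2 → ℝ} {p q : Torus2} {T : Flow ℝ Torus2} {a : ℝ}

lemma IsStoppingFunction.mem_diracSegment (h : IsStoppingFunction φ p q) (ν : Measure Torus2)
    [IsProbabilityMeasure ν] (hν : ∫ x, φ x ∂ν = 0) : ν ∈ diracSegment p q := by
  have hae : ∀ᵐ x ∂ν, x ∈ ({p} ∪ {q} : Set Torus2) := by
    have := (integral_eq_zero_iff_of_nonneg h.nonneg
      (integrable_of_continuous h.continuous ν)).1 hν
    filter_upwards [this] with x hx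
    exact (h.eq_zero_iff x).1 hx
  have hd : Disjoint ({p} : Set Torus2) {q} := by simpa using h.ne
  have hν' : ν = ν {p} • Measure.dirac p + ν {q} • Measure.dirac q := by
    conv_lhs => rw [← Measure.restrict_eq_self_of_ae_mem hae,
      Measure.restrict_union hd (measurableSet_singleton q), Measure.restrict_singleton,
      Measure.restrict_singleton]
  have h1 : ν {p} + ν {q} = 1 := by
    have : ν Set.univ = 1 := measure_univ
    rw [hν'] at this
    simpa using this
  refine ⟨ν.real {p}, measureReal_nonneg, measureReal_le_one, ?_⟩
  have h2 : ENNReal.ofReal (ν.real {p}) = ν {p} := by simp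
  have h3 : ENNReal.ofReal (1 - ν.real {p}) = ν {q} := by
    rw [ENNReal.ofReal_sub _ measureReal_nonneg, h2, ENNReal.ofReal_one, ← h1]
    exact ENNReal.add_sub_cancel_left (measure_ne_top _ _)
  rw [h2, h3]
  exact hν'

lemma isProbabilityMeasure_segment {c : ℝ} (h0 : 0 ≤ c) (h1 : c ≤ 1) :
    IsProbabilityMeasure
      (ENNReal.ofReal c • Measure.dirac p + ENNReal.ofReal (1 - c) • Measure.dirac q) := by
  constructor
  simp only [Measure.coe_add, Measure.coe_smul, Pi.add_apply, Pi.smul_apply, measure_univ,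
    smul_eq_mul, mul_one]
  rw [← ENNReal.ofReal_add h0 (by linarith)]
  simp

lemma integral_segment {c : ℝ} (h0 : 0 ≤ c) (h1 : c ≤ 1) (f : C(Torus2, ℝ)) :
    ∫ y, f y ∂(ENNReal.ofReal c • Measure.dirac p + ENNReal.ofReal (1 - c) • Measure.dirac q) =
      c * f p + (1 - c) * f q := by
  have hi : ∀ (z : Torus2) (r : ℝ),
      Integrable f (ENNReal.ofReal r • Measure.dirac z) := fun z r =>
    (integrable_of_continuous f.continuous (Measure.dirac z)).smul_measure ENNReal.ofReal_ne_top
  rw [integral_add_measure (hi _ _) (hi _ _), integral_smul_measure, integral_smul_measure,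
    integral_dirac, integral_dirac, ENNReal.toReal_ofReal h0, ENNReal.toReal_ofReal (by linarith)]
  simp

/-- The invariant measures of the flow are the convex combinations of the point masses at the
two fixed points. -/
theorem IsStoppingFunction.invariantMeasures_eq (h : IsStoppingFunction φ p q)
    (ha : Irrational a) (hT : IsGeneratedBy T φ a) : invariantMeasures T = diracSegment p q := by
  ext ν
  constructor
  · rintro ⟨hprob, hinv⟩
    refine h.mem_diracSegment ν ?_
    have hTc : Continuous fun z : Torus2 × ℝ => T z.2 z.1 :=
      T.continuous continuous_snd continuous_fst
    have hF : Continuous fun z : Torus2 × ℝ => φ (T z.2 z.1) := h.continuous.comp hTc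
    let f : C(Torus2, ℝ) := ⟨φ, h.continuous⟩
    -- Fubini and invariance make this integral independent of `n`, while dominated convergence
    -- sends it to zero; hence `φ` has integral zero.
    have hswap : ∀ n : ℕ, 0 < n → ∫ x, empirical T x n f ∂ν = ∫ x, φ x ∂ν := by
      intro n hn
      have hn' : (n : ℝ) ≠ 0 := by exact_mod_cast hn.ne'
      have hconst : ∀ s, ∫ x, φ (T s x) ∂ν = ∫ x, φ x ∂ν := fun s =>
        (hinv s).integral_comp' (f := (T.toHomeomorph s).toMeasurableEquiv) φ
      simp only [empirical]
      rw [integral_const_mul]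
      have := intervalIntegral_integral_swap (μ := ν) (a := 0) (b := n)
        (f := fun s x => φ (T s x)) ?_
      · change _ * ∫ x, (∫ s in (0 : ℝ)..n, φ (T s x)) ∂ν = _
        rw [← this]
        simp [hconst, hn']
      · obtain ⟨M, hM, hM'⟩ := h.exists_le
        have : IsFiniteMeasure (volume.restrict (Set.uIoc (0 : ℝ) n)) := ⟨by simp⟩
        refine Integrable.of_bound (C := M) ?_ (Eventually.of_forall fun z => ?_)
        · exact (hF.comp continuous_swap).aestronglyMeasurable
        · simpa [Function.uncurry, abs_of_nonneg (h.nonneg _)] using hM' _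
    have hlim : Tendsto (fun n : ℕ => ∫ x, empirical T x n f ∂ν) atTop (𝓝 (∫ _, (0 : ℝ) ∂ν)) := by
      obtain ⟨M, hM, hM'⟩ := h.exists_le
      refine tendsto_integral_of_dominated_convergence (fun _ => M) (fun n => ?_)
        (integrable_const _) (fun n => Eventually.of_forall fun x => ?_)
        (Eventually.of_forall fun x => ?_)
      · refine Continuous.aestronglyMeasurable (continuous_const.mul ?_)
        exact intervalIntegral.continuous_parametric_intervalIntegral_of_continuous'
          (f := fun x s => φ (T s x)) hF 0 n
      · rw [empirical, norm_mul, norm_inv]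
        have := intervalIntegral.norm_integral_le_of_norm_le_const (a := 0) (b := n) (C := M)
          (f := fun s => f (T s x)) fun s _ => by
            simpa [f, abs_of_nonneg (h.nonneg _)] using hM' _
        rcases Nat.eq_zero_or_pos n with rfl | hn
        · simpa using hM.le
        · rw [inv_mul_le_iff₀ (by simpa using hn)]
          simpa [mul_comm] using this
      · exact (h.tendsto_empirical ha hT x f h.left_eq_zero
          h.symm.left_eq_zero).comp tendsto_natCast_atTop_atTop
    have hev : (fun n : ℕ => ∫ x, empirical T x n f ∂ν) =ᶠ[atTop] fun _ => ∫ x, φ x ∂ν := by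
      filter_upwards [eventually_gt_atTop 0] with n hn using hswap n hn
    have := tendsto_nhds_unique (hlim.congr' hev) tendsto_const_nhds
    simpa using this.symm
  · rintro ⟨c, h0, h1, rfl⟩
    refine ⟨isProbabilityMeasure_segment h0 h1, fun t => ?_⟩
    have hm : Measurable (T t) := (T.continuous continuous_const continuous_id).measurable
    refine ⟨hm, ?_⟩
    rw [Measure.map_add _ _ hm, Measure.map_smul, Measure.map_smul, Measure.map_dirac' hm,
      Measure.map_dirac' hm, h.map_left hT, h.symm.map_left hT]

/-- Accumulation points of the empirical measures are supported on the fixed points. -/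
lemma IsStoppingFunction.accumulationMeasures_subset (h : IsStoppingFunction φ p q)
    (ha : Irrational a) (hT : IsGeneratedBy T φ a) (x : Torus2) :
    accumulationMeasures T x ⊆ diracSegment p q := by
  rintro ν ⟨hprob, τ, hτ, hlim⟩
  refine h.mem_diracSegment ν ?_
  exact tendsto_nhds_unique (hlim ⟨φ, h.continuous⟩)
    ((h.tendsto_empirical ha hT x ⟨φ, h.continuous⟩ h.left_eq_zero h.symm.left_eq_zero).comp hτ)

/-- If the empirical averages of functions vanishing at either one of the fixed points come close
to zero, then every convex combination of the point masses is an accumulation point. -/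
lemma IsStoppingFunction.diracSegment_subset (h : IsStoppingFunction φ p q)
    (ha : Irrational a) (hT : IsGeneratedBy T φ a) (x : Torus2)
    (hp : ∀ g : C(Torus2, ℝ), (∀ y, 0 ≤ g y) → g p = 0 → ∀ ε > 0, ∀ N : ℝ, ∃ t > N,
      empirical T x t g < ε)
    (hq : ∀ g : C(Torus2, ℝ), (∀ y, 0 ≤ g y) → g q = 0 → ∀ ε > 0, ∀ N : ℝ, ∃ t > N,
      empirical T x t g < ε) :
    diracSegment p q ⊆ accumulationMeasures T x := by
  rintro _ ⟨c, h0, h1, rfl⟩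
  have hcT := continuous_flow_right T x
  have hden : ∀ y : Torus2, ‖y - p‖ + ‖y - q‖ ≠ 0 := fun y hy => by
    have e1 : ‖y - p‖ = 0 := by linarith [norm_nonneg (y - p), norm_nonneg (y - q)]
    have e2 : ‖y - q‖ = 0 := by linarith [norm_nonneg (y - p), norm_nonneg (y - q)]
    exact h.ne ((sub_eq_zero.1 (norm_eq_zero.1 e1)).symm.trans (sub_eq_zero.1 (norm_eq_zero.1 e2)))
  have hpq : ‖p - q‖ ≠ 0 := norm_ne_zero_iff.2 (sub_ne_zero.2 h.ne)
  -- A Urysohn function, 1 at `p` and 0 at `q`: its averages measure the asymptotic mass at `p`.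
  let g : C(Torus2, ℝ) := ⟨fun y => ‖y - q‖ / (‖y - p‖ + ‖y - q‖),
    Continuous.div (by fun_prop) (by fun_prop) hden⟩
  have hg : ∀ y, g y = ‖y - q‖ / (‖y - p‖ + ‖y - q‖) := fun _ => rfl
  have hgp : g p = 1 := by simp [hg, hpq]
  have hgq : g q = 0 := by simp [hg]
  have hg0 : ∀ y, 0 ≤ g y := fun y => by rw [hg]; positivity
  have hg1 : ∀ y, g y ≤ 1 := fun y => by
    rw [hg]
    exact div_le_one_of_le₀ (by linarith [norm_nonneg (y - p)]) (by positivity)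
  have hcompl : ∀ t > 0, empirical T x t (1 - g) = 1 - empirical T x t g := by
    intro t ht
    simp only [empirical, ContinuousMap.sub_apply, ContinuousMap.one_apply]
    have hgi : IntervalIntegrable (fun s => g (T s x)) volume 0 t :=
      (g.continuous.comp hcT).intervalIntegrable _ _
    rw [intervalIntegral.integral_sub (by simp) hgi, mul_sub]
    simp [ht.ne']
  have hEc : ContinuousOn (fun t => empirical T x t g) (Set.Ioi 0) := by
    refine ContinuousOn.mul (continuousOn_id.inv₀ fun t ht => ne_of_gt ht) ?_
    exact (intervalIntegral.continuous_primitive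
      (fun a b => (g.continuous.comp hcT).intervalIntegrable a b) 0).continuousOn
  -- At `t₁` the average is nearly 0 and at `t₂` nearly 1. Either one of them is already close to
  -- `c`, or `c` lies between them and is attained.
  have hex : ∀ n : ℕ, ∃ t : ℝ, (n : ℝ) ≤ t ∧ |empirical T x t g - c| < 1 / ((n : ℝ) + 1) := by
    intro n
    have hε : 0 < 1 / ((n : ℝ) + 1) := by positivity
    obtain ⟨t₁, ht₁, he₁⟩ := hq g hg0 hgq _ hε n
    obtain ⟨t₂, ht₂, he₂⟩ := hp (1 - g) (fun y => by simpa using hg1 y) (by simp [hgp]) _ hε n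
    have hn0 : (0 : ℝ) ≤ n := by positivity
    rw [hcompl t₂ (by linarith)] at he₂
    rcases lt_or_ge c (empirical T x t₁ g) with hc | hc
    · exact ⟨t₁, ht₁.le, by rw [abs_lt]; constructor <;> linarith⟩
    rcases lt_or_ge (empirical T x t₂ g) c with hc' | hc'
    · exact ⟨t₂, ht₂.le, by rw [abs_lt]; constructor <;> linarith⟩
    have hsub : Set.uIcc t₁ t₂ ⊆ Set.Ioi (n : ℝ) := fun s hs =>
      lt_of_lt_of_le (lt_min ht₁ ht₂) hs.1
    have := intermediate_value_uIcc (hEc.mono (hsub.trans (Set.Ioi_subset_Ioi hn0)))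
    obtain ⟨t, ht, he⟩ := this (Set.mem_uIcc.2 (Or.inl ⟨hc, hc'⟩))
    refine ⟨t, (hsub ht).le, ?_⟩
    simpa [he] using hε
  choose τ hτ hτ' using hex
  have hτlim : Tendsto τ atTop atTop := tendsto_atTop_mono hτ tendsto_natCast_atTop_atTop
  have hgl : Tendsto (fun n => empirical T x (τ n) g) atTop (𝓝 c) := by
    rw [tendsto_iff_dist_tendsto_zero]
    exact squeeze_zero (fun _ => dist_nonneg) (fun n => (hτ' n).le)
      tendsto_one_div_add_atTop_nhds_zero_nat
  refine ⟨isProbabilityMeasure_segment h0 h1, τ, hτlim, fun f => ?_⟩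
  rw [integral_segment h0 h1]
  -- Modulo a function vanishing at both zeros, every `f` is an affine function of `g`.
  let r : C(Torus2, ℝ) := f - (f p - f q) • g - ContinuousMap.const _ (f q)
  have hr : Tendsto (fun n => empirical T x (τ n) r) atTop (𝓝 0) :=
    (h.tendsto_empirical ha hT x r (by simp [r, hgp]) (by simp [r, hgq])).comp hτlim
  have hsum := (hr.add (hgl.const_mul (f p - f q))).add_const (f q)
  have hval : 0 + (f p - f q) * c + f q = c * f p + (1 - c) * f q := by ring
  rw [hval] at hsum
  refine hsum.congr' ?_
  filter_upwards [hτlim.eventually_gt_atTop 0] with n hn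
  simp only [empirical, r, ContinuousMap.sub_apply, ContinuousMap.smul_apply, smul_eq_mul,
    ContinuousMap.const_apply]
  have i1 : IntervalIntegrable (fun s => f (T s x)) volume 0 (τ n) :=
    (f.continuous.comp hcT).intervalIntegrable _ _
  have i2 : IntervalIntegrable (fun s => (f p - f q) * g (T s x)) volume 0 (τ n) :=
    (continuous_const.mul (g.continuous.comp hcT)).intervalIntegrable _ _
  rw [intervalIntegral.integral_sub (i1.sub i2) (continuous_const.intervalIntegrable _ _),
    intervalIntegral.integral_sub i1 i2, intervalIntegral.integral_const_mul,
    intervalIntegral.integral_const]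
  simp only [sub_zero, smul_eq_mul]
  field_simp
  ring

end Measures

/-! ### Travel times and crossings near the zeros -/

section Crossings

variable {φ : Torus2 → ℝ} {p q : Torus2} {T : Flow ℝ Torus2} {a : ℝ} {x : Torus2} {θ : ℝ → ℝ}

/-- The representative in `[0, 1)` of a point of the circle. -/
def fundLift (z : UnitAddCircle) : ℝ := AddCircle.equivIco 1 0 z

lemma coe_fundLift (z : UnitAddCircle) : (fundLift z : UnitAddCircle) = z :=
  (AddCircle.equivIco 1 0).symm_apply_apply z

lemma fundLift_mem (z : UnitAddCircle) : fundLift z ∈ Set.Ico (0 : ℝ) 1 := by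
  simpa [fundLift] using (AddCircle.equivIco 1 0 z).2

/-- The vertical offset from `z` of the first crossing of the line `line a` with the vertical
circle through `z`. -/
def offset (a : ℝ) (z : Torus2) : UnitAddCircle := ((a * fundLift z.1 : ℝ) : UnitAddCircle) - z.2

/-- Applied with `z = p - x`, this reads the crossings of the line through `x` with the vertical
circle of `p` as an orbit of the rotation by `a`. -/
lemma line_sub_eq (a : ℝ) (z : Torus2) (k : ℤ) :
    line a (fundLift z.1 + k) - z = (0, offset a z + k • (a : UnitAddCircle)) := by
  ext
  · simp [line, coe_fundLift]
  · simp only [line, offset, Prod.snd_sub, mul_add, AddCircle.coe_add]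
    rw [show a * (k : ℝ) = k • a by simp [mul_comm], AddCircle.coe_zsmul]
    abel

/-- Controls the time spent near the second zero up to the `n`-th crossing. -/
def crossingSum (α v : UnitAddCircle) (n : ℕ) : ℝ :=
  ∑ k ∈ Finset.range (n + 3), ‖v + ((k : ℤ) - 1) • α‖⁻¹

/-- The orbit of `u` has exceptionally close returns to `0` compared with the orbit of `v`. -/
def IsDominant (α u v : UnitAddCircle) : Prop :=
  (∀ k : ℤ, u + k • α ≠ 0) ∧ (∀ k : ℤ, v + k • α ≠ 0) ∧
    ∀ ε > 0, ∃ᶠ n : ℕ in atTop, ‖u + (n : ℤ) • α‖ * crossingSum α v n < ε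

/-- Hitting `p` would be a crossing of zero offset. -/
lemma add_line_ne (hu : ∀ k : ℤ, offset a (p - x) + k • (a : UnitAddCircle) ≠ 0) (σ : ℝ) :
    x + line a σ ≠ p := by
  intro hσ
  have h1 : line a σ = p - x := by rw [← hσ]; abel
  have h2 : (σ : UnitAddCircle) = (fundLift (p - x).1 : ℝ) := by
    rw [coe_fundLift, ← h1]
    rfl
  obtain ⟨k, hk⟩ := exists_int_of_coe_eq h2
  have h3 := line_sub_eq a (p - x) k
  rw [← hk, h1, sub_self] at h3
  exact hu k (Prod.ext_iff.1 h3).2.symm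

lemma norm_line_le (a σ : ℝ) : ‖line a σ‖ ≤ (1 + |a|) * |σ| := by
  refine max_le ((norm_coe_circle_le σ).trans ?_) ((norm_coe_circle_le _).trans ?_)
  · nlinarith [abs_nonneg a, abs_nonneg σ]
  · rw [abs_mul]
    nlinarith [abs_nonneg a, abs_nonneg σ]

lemma integral_inv_sq_add_sq_le {d : ℝ} (hd : 0 < d) (s A B : ℝ) :
    ∫ σ in A..B, (d ^ 2 + (σ - s) ^ 2)⁻¹ ≤ Real.pi * d⁻¹ := by
  have hder : ∀ σ ∈ Set.uIcc A B, HasDerivAt (fun σ => d⁻¹ * Real.arctan ((σ - s) / d))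
      ((d ^ 2 + (σ - s) ^ 2)⁻¹) σ := by
    intro σ _
    have h1 : HasDerivAt (fun σ : ℝ => (σ - s) / d) (1 / d) σ :=
      ((hasDerivAt_id σ).sub_const s).div_const d
    refine (h1.arctan.const_mul d⁻¹).congr_deriv ?_
    have : d ^ 2 + (σ - s) ^ 2 ≠ 0 := by positivity
    field_simp
  have hcont : Continuous fun σ : ℝ => (d ^ 2 + (σ - s) ^ 2)⁻¹ :=
    Continuous.inv₀ (by fun_prop) fun σ => by positivity
  rw [intervalIntegral.integral_eq_sub_of_hasDerivAt hder (hcont.intervalIntegrable _ _)]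
  have h1 := Real.arctan_lt_pi_div_two ((B - s) / d)
  have h2 := Real.neg_pi_div_two_lt_arctan ((A - s) / d)
  have h3 : 0 < d⁻¹ := by positivity
  nlinarith

/-- The distance to `q` along the orbit is controlled by the distance at the nearest crossing. -/
lemma inv_sq_le_crossing (hv : ∀ k : ℤ, offset a (q - x) + k • (a : UnitAddCircle) ≠ 0) (n : ℕ)
    {σ : ℝ} (h0 : 0 ≤ σ) (h1 : σ ≤ n + 1) :
    (‖x + line a σ - q‖ ^ 2)⁻¹ ≤ ∑ k ∈ Finset.range (n + 3), ((1 + |a|) ^ 2 + 1) *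
      (‖offset a (q - x) + ((k : ℤ) - 1) • (a : UnitAddCircle)‖ ^ 2 +
        (σ - (fundLift (q - x).1 + ((k : ℤ) - 1 : ℤ))) ^ 2)⁻¹ := by
  set w := fundLift (q - x).1 with hw
  obtain ⟨hw0, hw1⟩ := fundLift_mem (q - x).1
  rw [← hw] at hw0 hw1
  -- The index of the nearest crossing. As `0 ≤ w < 1` and `0 ≤ σ ≤ n + 1`, it lies between `-1` and
  -- `n + 1`, whence the `n + 3` terms and the shift by one in `crossingSum`.
  set m := round (σ - w) with hm
  have hm0 : -1 ≤ m := by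
    have : ((-2 : ℤ) : ℝ) < m := by
      have := sub_half_lt_round (σ - w)
      push_cast
      linarith
    have := Int.cast_lt.1 this
    omega
  have hm1 : m ≤ n + 1 := by
    have : (m : ℝ) < ((n + 2 : ℤ) : ℝ) := by
      have := round_le_add_half (σ - w)
      push_cast
      linarith
    have := Int.cast_lt.1 this
    omega
  obtain ⟨k, hk⟩ : ∃ k : ℕ, (k : ℤ) = m + 1 := ⟨(m + 1).toNat, by omega⟩
  have hkm : (k : ℤ) - 1 = m := by omega
  refine le_trans ?_ (Finset.single_le_sum (f := fun k : ℕ => ((1 + |a|) ^ 2 + 1) *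
      (‖offset a (q - x) + ((k : ℤ) - 1) • (a : UnitAddCircle)‖ ^ 2 +
        (σ - (w + ((k : ℤ) - 1 : ℤ))) ^ 2)⁻¹) (fun _ _ => by positivity)
      (Finset.mem_range.2 (show k < n + 3 by omega)))
  simp only [hkm]
  set d := ‖offset a (q - x) + m • (a : UnitAddCircle)‖ with hd
  have hd0 : 0 < d := norm_pos_iff.2 (hv m)
  set D := ‖x + line a σ - q‖ with hD
  have hDpos : 0 < D := norm_pos_iff.2 (sub_ne_zero.2 (add_line_ne hv σ))
  have e1 : |σ - (w + m)| ≤ D := by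
    have : ‖((σ - w : ℝ) : UnitAddCircle)‖ = |σ - (w + m)| := by
      rw [UnitAddCircle.norm_eq, ← hm, sub_sub]
    rw [← this]
    refine le_trans (le_of_eq ?_) (norm_fst_le (x + line a σ - q))
    congr 1
    rw [AddCircle.coe_sub, hw, coe_fundLift]
    simp only [line, Prod.fst_sub, Prod.fst_add]
    abel
  -- Sliding along the line to the crossing covers a horizontal distance at most `D`, hence a
  -- vertical one at most `|a| * D`.
  have e2 : d ≤ (1 + |a|) * D := by
    have h3 : (0, offset a (q - x) + m • (a : UnitAddCircle)) =
        (x + line a σ - q) + line a ((w + m) - σ) := by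
      rw [← line_sub_eq, ← hw]
      have := line_add a σ ((w + m) - σ)
      rw [add_sub_cancel] at this
      rw [this]
      abel
    have h4 : d = ‖((x + line a σ - q) + line a ((w + m) - σ)).2‖ := by rw [← h3]
    rw [h4, Prod.snd_add]
    refine (norm_add_le _ _).trans ?_
    have h5 : ‖(line a ((w + m) - σ)).2‖ ≤ |a| * D := by
      refine (norm_coe_circle_le _).trans ?_
      rw [abs_mul, abs_sub_comm]
      gcongr
    have h6 := norm_snd_le (x + line a σ - q)
    linarith
  rw [← div_eq_mul_inv, le_div_iff₀ (by positivity), inv_mul_le_iff₀ (by positivity)]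
  have e3 : (σ - (w + m)) ^ 2 ≤ D ^ 2 := sq_le_sq' (abs_le.1 e1).1 (abs_le.1 e1).2
  have e4 : d ^ 2 ≤ ((1 + |a|) * D) ^ 2 := by gcongr
  nlinarith

lemma continuous_inv_sq_orbit (hv : ∀ k : ℤ, offset a (q - x) + k • (a : UnitAddCircle) ≠ 0) :
    Continuous fun σ => (‖x + line a σ - q‖ ^ 2)⁻¹ :=
  Continuous.inv₀ ((((continuous_const.add (continuous_line a)).sub continuous_const).norm).pow 2)
    fun σ => pow_ne_zero 2 (norm_ne_zero_iff.2 (sub_ne_zero.2 (add_line_ne hv σ)))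

/-- Each crossing at distance `d` contributes at most `π / d`, by the arctangent integral. -/
lemma integral_inv_sq_le_crossingSum
    (hv : ∀ k : ℤ, offset a (q - x) + k • (a : UnitAddCircle) ≠ 0) (n : ℕ) {s : ℝ} (hs0 : 0 ≤ s)
    (hs : s ≤ n + 1) :
    ∫ σ in (0 : ℝ)..s, (‖x + line a σ - q‖ ^ 2)⁻¹ ≤
      ((1 + |a|) ^ 2 + 1) * Real.pi * crossingSum a (offset a (q - x)) n := by
  have hd : ∀ k : ℤ, 0 < ‖offset a (q - x) + k • (a : UnitAddCircle)‖ := fun k =>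
    norm_pos_iff.2 (hv k)
  have hc : ∀ k ∈ Finset.range (n + 3), Continuous fun σ : ℝ => ((1 + |a|) ^ 2 + 1) *
      (‖offset a (q - x) + ((k : ℤ) - 1) • (a : UnitAddCircle)‖ ^ 2 +
        (σ - (fundLift (q - x).1 + ((k : ℤ) - 1 : ℤ))) ^ 2)⁻¹ := fun k _ =>
    continuous_const.mul (Continuous.inv₀ (by fun_prop) fun σ => by
      have := hd ((k : ℤ) - 1)
      positivity)
  have := intervalIntegral.integral_mono_on hs0
    ((continuous_inv_sq_orbit hv).intervalIntegrable (μ := volume) 0 s)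
    ((continuous_finsetSum _ hc).intervalIntegrable 0 s)
    fun σ hσ => inv_sq_le_crossing hv n hσ.1 (hσ.2.trans hs)
  refine this.trans ?_
  rw [intervalIntegral.integral_finsetSum fun k hk => (hc k hk).intervalIntegrable _ _,
    crossingSum, Finset.mul_sum]
  refine Finset.sum_le_sum fun k _ => ?_
  rw [intervalIntegral.integral_const_mul, mul_assoc]
  gcongr
  exact integral_inv_sq_add_sq_le (hd _) _ _ _

/-- The orbit needs a long time to reach a crossing close to `p`. -/
lemma IsParam.inv_le_time (hθ : IsParam φ a x θ) (h : IsStoppingFunction φ p q) :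
    ∃ c > 0, ∀ n : ℕ, 1 ≤ n → offset a (p - x) + (n : ℤ) • (a : UnitAddCircle) ≠ 0 → ∀ t, 0 ≤ t →
      θ t = fundLift (p - x).1 + n →
      ‖offset a (p - x) + (n : ℤ) • (a : UnitAddCircle)‖⁻¹ ≤ c * t := by
  obtain ⟨C, hC, hC'⟩ := h.exists_le_sq
  refine ⟨C * (2 + |a|) ^ 2 + 1, by positivity, fun n hn hne t ht hθt => ?_⟩
  set d := ‖offset a (p - x) + (n : ℤ) • (a : UnitAddCircle)‖ with hd
  have hd0 : 0 < d := norm_pos_iff.2 hne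
  have hd1 : d ≤ 1 := by
    have := norm_torus_le (0, offset a (p - x) + (n : ℤ) • (a : UnitAddCircle))
    exact (norm_snd_le (0, offset a (p - x) + (n : ℤ) • (a : UnitAddCircle))).trans this
  have hs : 1 ≤ θ t := by
    have h1 : (1 : ℝ) ≤ n := by exact_mod_cast hn
    have := (fundLift_mem (p - x).1).1
    linarith
  -- On the last stretch of length `d` before the crossing, `φ` is at most a multiple of `d ^ 2`,
  -- the size of the regularization chosen here; that stretch alone costs time of order `1 / d`. It
  -- starts after 0 because `d ≤ 1 ≤ θ t`.
  have h1 := hθ.integral_inv_le h (pow_pos hd0 2) ht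
  have hcont : Continuous fun σ => (φ (x + line a σ) + d ^ 2)⁻¹ :=
    (continuous_inv_add h (pow_pos hd0 2)).comp (continuous_const.add (continuous_line a))
  have hpos : ∀ σ, 0 ≤ (φ (x + line a σ) + d ^ 2)⁻¹ := fun σ => by
    have := h.nonneg (x + line a σ)
    positivity
  have h2 : ∫ σ in (θ t - d)..θ t, (φ (x + line a σ) + d ^ 2)⁻¹ ≤
      ∫ σ in (0 : ℝ)..θ t, (φ (x + line a σ) + d ^ 2)⁻¹ :=
    intervalIntegral.integral_mono_interval (by linarith) (by linarith) le_rfl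
      (Eventually.of_forall hpos) (hcont.intervalIntegrable _ _)
  have hlow : ∀ σ ∈ Set.Icc (θ t - d) (θ t),
      ((C * (2 + |a|) ^ 2 + 1) * d ^ 2)⁻¹ ≤ (φ (x + line a σ) + d ^ 2)⁻¹ := by
    intro σ hσ
    have e0 := h.nonneg (x + line a σ)
    have e1 : ‖x + line a σ - p‖ ≤ (2 + |a|) * d := by
      have e2 : x + line a σ - p =
          (0, offset a (p - x) + (n : ℤ) • (a : UnitAddCircle)) + line a (σ - θ t) := by
        rw [← line_sub_eq, Int.cast_natCast, ← hθt]
        have := line_add a (θ t) (σ - θ t)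
        rw [add_sub_cancel] at this
        rw [this]
        abel
      rw [e2]
      refine (norm_add_le _ _).trans ?_
      have e3 : ‖((0 : UnitAddCircle), offset a (p - x) + (n : ℤ) • (a : UnitAddCircle))‖ = d := by
        simp [Prod.norm_def, hd]
      have e4 := norm_line_le a (σ - θ t)
      have e5 : |σ - θ t| ≤ d := abs_le.2 ⟨by linarith [hσ.1], by linarith [hσ.2]⟩
      have e6 : (1 + |a|) * |σ - θ t| ≤ (1 + |a|) * d := by gcongr
      rw [e3]
      linarith
    gcongr
    have e7 := hC' (x + line a σ)
    have e8 : C * ‖x + line a σ - p‖ ^ 2 ≤ C * ((2 + |a|) * d) ^ 2 := by gcongr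
    nlinarith
  have h3 := intervalIntegral.integral_mono_on (μ := volume) (by linarith : θ t - d ≤ θ t)
    intervalIntegrable_const (hcont.intervalIntegrable _ _) hlow
  rw [intervalIntegral.integral_const, smul_eq_mul] at h3
  have h4 := (h3.trans h2).trans h1
  have h5 : (θ t - (θ t - d)) * ((C * (2 + |a|) ^ 2 + 1) * d ^ 2)⁻¹ =
      (C * (2 + |a|) ^ 2 + 1)⁻¹ * d⁻¹ := by
    field_simp
    ring
  rw [h5, inv_mul_le_iff₀ (by positivity)] at h4
  exact h4

/-- An orbit avoiding the zeros of `φ` covers the whole forward half-line. -/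
lemma IsParam.exists_eq (hθ : IsParam φ a x θ) (h : IsStoppingFunction φ p q)
    (hp : ∀ σ, x + line a σ ≠ p) (hq : ∀ σ, x + line a σ ≠ q) {s : ℝ} (hs : 0 ≤ s) :
    ∃ t, 0 ≤ t ∧ θ t = s := by
  have hcont : Continuous fun σ => φ (x + line a σ) :=
    h.continuous.comp (continuous_const.add (continuous_line a))
  -- Up to displacement `s` the speed is at least its minimum `m > 0`, so `s` is reached by time `s
  -- / m`.
  obtain ⟨σ₀, -, hmin⟩ := isCompact_Icc.exists_isMinOn (Set.nonempty_Icc.2 hs) hcont.continuousOn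
  set m := φ (x + line a σ₀)
  have hm : 0 < m := h.pos (hp _) (hq _)
  have hsm : 0 ≤ s / m := by positivity
  have hreach : s ≤ θ (s / m) := by
    by_contra! hlt
    have h1 := hθ.integral_comp h (fun _ => 1) (s / m)
    simp only [one_mul, intervalIntegral.integral_const, sub_zero, smul_eq_mul, mul_one] at h1
    have h2 := intervalIntegral.integral_mono_on (μ := volume) hsm
      (f := fun _ => m) intervalIntegrable_const
      ((h.continuous.comp hθ.continuous_orbit).intervalIntegrable 0 (s / m))
      fun r hr => hmin ⟨hθ.nonneg h hr.1, ((hθ.monotone h hr.2).trans_lt hlt).le⟩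
    simp only [Function.comp_def] at h2
    rw [h1, intervalIntegral.integral_const, smul_eq_mul, sub_zero, div_mul_cancel₀ _ hm.ne'] at h2
    linarith
  have := intermediate_value_Icc hsm hθ.continuous.continuousOn
  rw [hθ.zero] at this
  obtain ⟨t, ht, hts⟩ := this ⟨hs, hreach⟩
  exact ⟨t, ht.1, hts⟩

/-- If the close returns to `p` dominate, then the empirical measures come close to `δ_p`. -/
lemma IsDominant.exists_empirical_lt (h : IsStoppingFunction φ p q) (hT : IsGeneratedBy T φ a)
    (hD : IsDominant a (offset a (p - x)) (offset a (q - x))) (g : C(Torus2, ℝ))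
    (hg : ∀ y, 0 ≤ g y) (hgp : g p = 0) (ε : ℝ) (hε : 0 < ε) (N : ℝ) :
    ∃ t > N, empirical T x t g < ε := by
  obtain ⟨hu, hv, hfreq⟩ := hD
  obtain ⟨θ, hθ, hθT⟩ := hT.exists_isParam x
  obtain ⟨c, hc, htime⟩ := hθ.inv_le_time h
  obtain ⟨C, hC, hCg⟩ := h.exists_abs_mul_sq_le g hgp (ε := ε / 2) (by positivity)
  set A := C * (((1 + |a|) ^ 2 + 1) * Real.pi) with hA
  have hA0 : 0 ≤ A := by have := Real.pi_pos; positivity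
  -- The time `t` will satisfy `1 ≤ c * t * d`, so `A * S ≤ A * c * t * (d * S)`; this bound on `d *
  -- S` brings it below `ε / 2 * t`, the `+ 1` covering `A = 0`.
  have hε' : 0 < ε / (2 * (A * c + 1)) := by positivity
  -- This threshold puts the crossing beyond `θ N`, hence its time beyond `N`, and ensures `1 ≤ n`.
  obtain ⟨n, hn, hnε⟩ := frequently_atTop.1 (hfreq _ hε') (⌈|θ N|⌉₊ + 1)
  have hnN : θ N < n := by
    have e1 := Nat.le_ceil |θ N|
    have e2 : ((⌈|θ N|⌉₊ + 1 : ℕ) : ℝ) ≤ n := by exact_mod_cast hn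
    push_cast at e2
    linarith [le_abs_self (θ N)]
  obtain ⟨hw0, hw1⟩ := fundLift_mem (p - x).1
  obtain ⟨t, ht0, ht⟩ := hθ.exists_eq h (add_line_ne hu) (add_line_ne hv)
    (show 0 ≤ fundLift (p - x).1 + n by positivity)
  have htN : N < t := by
    by_contra! hle
    have := hθ.monotone h hle
    linarith
  refine ⟨t, htN, ?_⟩
  set d := ‖offset a (p - x) + (n : ℤ) • (a : UnitAddCircle)‖ with hd
  have hd0 : 0 < d := norm_pos_iff.2 (hu n)
  have hdt : d⁻¹ ≤ c * t := htime n (by omega) (hu n) t ht0 ht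
  have htpos : 0 < t := by
    have : 0 < c * t := lt_of_lt_of_le (by positivity) hdt
    exact pos_of_mul_pos_right this hc.le
  set S := crossingSum a (offset a (q - x)) n
  have hS0 : 0 ≤ S := Finset.sum_nonneg fun _ _ => by positivity
  have hI := integral_inv_sq_le_crossingSum hv n (hθ.nonneg h ht0)
    (show θ t ≤ n + 1 by linarith)
  have hcR : Continuous fun s => C * ((‖x + line a (θ s) - q‖ ^ 2)⁻¹ * φ (x + line a (θ s))) :=
    continuous_const.mul (((continuous_inv_sq_orbit hv).comp hθ.continuous).mul
      (h.continuous.comp hθ.continuous_orbit))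
  -- Bounding `g` by `ε / 2 + C * φ / ‖· - q‖ ^ 2` leaves a factor `φ` that the change of variables
  -- absorbs.
  have hbound : ∫ s in (0 : ℝ)..t, g (T s x) ≤ ε / 2 * t + A * S := by
    calc ∫ s in (0 : ℝ)..t, g (T s x)
        ≤ ∫ s in (0 : ℝ)..t, (ε / 2 +
            C * ((‖x + line a (θ s) - q‖ ^ 2)⁻¹ * φ (x + line a (θ s)))) := by
          refine intervalIntegral.integral_mono_on ht0
            ((g.continuous.comp (continuous_flow_right T x)).intervalIntegrable _ _)
            ((continuous_const.add hcR).intervalIntegrable _ _) fun s _ => ?_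
          rw [hθT]
          have e1 := hCg (x + line a (θ s))
          have e2 : 0 < ‖x + line a (θ s) - q‖ ^ 2 :=
            pow_pos (norm_pos_iff.2 (sub_ne_zero.2 (add_line_ne hv _))) 2
          rw [abs_of_nonneg (hg _), ← le_div_iff₀ e2] at e1
          refine e1.trans (le_of_eq ?_)
          rw [add_div, mul_div_cancel_right₀ _ e2.ne']
          ring
      _ = ε / 2 * t + C * ∫ σ in (0 : ℝ)..θ t, (‖x + line a σ - q‖ ^ 2)⁻¹ := by
          rw [intervalIntegral.integral_add intervalIntegrable_const (hcR.intervalIntegrable _ _),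
            intervalIntegral.integral_const_mul,
            hθ.integral_comp h (fun σ => (‖x + line a σ - q‖ ^ 2)⁻¹)]
          simp
          ring
      _ ≤ ε / 2 * t + C * (((1 + |a|) ^ 2 + 1) * Real.pi * S) := by gcongr
      _ = ε / 2 * t + A * S := by rw [hA]; ring
  rw [empirical, inv_mul_lt_iff₀ htpos]
  refine hbound.trans_lt ?_
  have h1 : A * S ≤ A * (c * t * (d * S)) := by
    have : 1 ≤ c * t * d := by
      rw [inv_le_iff_one_le_mul₀ hd0] at hdt
      linarith
    have : 1 * S ≤ (c * t * d) * S := by gcongr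
    have : S ≤ c * t * (d * S) := by linarith
    gcongr
  have h2 : A * (c * t * (d * S)) ≤ A * (c * t * (ε / (2 * (A * c + 1)))) := by gcongr
  have h3 : A * (c * t * (ε / (2 * (A * c + 1)))) < ε / 2 * t := by
    have e : A * (c * t * (ε / (2 * (A * c + 1)))) = (A * c / (A * c + 1)) * (ε / 2 * t) := by
      field_simp
    rw [e]
    have : A * c / (A * c + 1) < 1 := by
      rw [div_lt_one (by positivity)]
      linarith
    have h4 : 0 < ε / 2 * t := by positivity
    nlinarith
  linarith

end Crossings

/-! ### A thinned Borel–Cantelli lemma -/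

section BorelCantelli

variable {Ω : Type*} [MeasurableSpace Ω] {μ : Measure Ω} [IsProbabilityMeasure μ]
  {A B : ℕ → Set Ω} {δ : ℝ}

/-- A second moment bound for the union of pairwise independent events, thinned by further events
of large conditional probability. -/
lemma le_measureReal_biUnion (hA : ∀ n, MeasurableSet (A n)) (hB : ∀ n, MeasurableSet (B n))
    (hind : ∀ m n, m ≠ n → μ.real (A m ∩ A n) = μ.real (A m) * μ.real (A n))
    (hAB : ∀ n, (1 - δ) * μ.real (A n) ≤ μ.real (A n ∩ B n)) (s : Finset ℕ)
    (hs : 0 < ∑ n ∈ s, μ.real (A n)) :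
    1 - 2 * δ - (∑ n ∈ s, μ.real (A n))⁻¹ ≤ μ.real (⋃ n ∈ s, A n ∩ B n) := by
  set e := ∑ n ∈ s, μ.real (A n) with he
  set E := ⋃ n ∈ s, A n ∩ B n with hE
  have hEm : MeasurableSet E := s.measurableSet_biUnion fun n _ => (hA n).inter (hB n)
  have hint : ∀ {S : Set Ω}, MeasurableSet S → Integrable (S.indicator (1 : Ω → ℝ)) μ := fun hS =>
    (integrable_const (1 : ℝ)).indicator hS
  set Y : Ω → ℝ := fun ω => ∑ n ∈ s, (A n ∩ B n).indicator (1 : Ω → ℝ) ω with hY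
  set Z : Ω → ℝ := fun ω => ∑ m ∈ s, ∑ n ∈ s, (A m ∩ A n).indicator (1 : Ω → ℝ) ω with hZ
  have hYI : ∫ ω, Y ω ∂μ = ∑ n ∈ s, μ.real (A n ∩ B n) := by
    rw [hY, integral_finsetSum _ fun n _ => hint ((hA n).inter (hB n))]
    exact Finset.sum_congr rfl fun n _ => integral_indicator_one ((hA n).inter (hB n))
  have hZI : ∫ ω, Z ω ∂μ ≤ e ^ 2 + e := by
    rw [hZ, integral_finsetSum _ fun m _ => integrable_finsetSum _ fun n _ =>
      hint ((hA m).inter (hA n))]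
    have : ∀ m ∈ s, ∫ ω, ∑ n ∈ s, (A m ∩ A n).indicator (1 : Ω → ℝ) ω ∂μ ≤
        μ.real (A m) * e + μ.real (A m) := by
      intro m hm
      rw [integral_finsetSum _ fun n _ => hint ((hA m).inter (hA n))]
      have h1 : ∀ n ∈ s, ∫ ω, (A m ∩ A n).indicator (1 : Ω → ℝ) ω ∂μ ≤
          μ.real (A m) * μ.real (A n) + if m = n then μ.real (A m) else 0 := by
        intro n _
        rw [integral_indicator_one ((hA m).inter (hA n))]
        split_ifs with hmn
        · subst hmn
          rw [Set.inter_self]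
          have : 0 ≤ μ.real (A m) * μ.real (A m) := by positivity
          linarith
        · rw [hind m n hmn, add_zero]
      refine (Finset.sum_le_sum h1).trans (le_of_eq ?_)
      rw [Finset.sum_add_distrib, ← Finset.mul_sum, Finset.sum_ite_eq, if_pos hm]
    refine (Finset.sum_le_sum this).trans (le_of_eq ?_)
    rw [Finset.sum_add_distrib, ← Finset.sum_mul]
    ring
  -- On `E` this is `(Y - e) ^ 2 ≥ 0` together with `Y ^ 2 ≤ Z`; off `E`, `Y` vanishes. Its integral
  -- plays the role of Cauchy–Schwarz.
  have hpt : ∀ ω, 2 * e * Y ω ≤ Z ω + e ^ 2 * E.indicator (1 : Ω → ℝ) ω := by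
    intro ω
    have hY0 : 0 ≤ Y ω := Finset.sum_nonneg fun n _ =>
      Set.indicator_nonneg (fun _ _ => zero_le_one) _
    have hYZ : Y ω ^ 2 ≤ Z ω := by
      have : Z ω = (∑ n ∈ s, (A n).indicator (1 : Ω → ℝ) ω) ^ 2 := by
        rw [sq, Finset.sum_mul_sum]
        refine Finset.sum_congr rfl fun m _ => Finset.sum_congr rfl fun n _ => ?_
        rw [Set.inter_indicator_one]
        rfl
      rw [this]
      refine pow_le_pow_left₀ hY0 (Finset.sum_le_sum fun n _ => ?_) 2
      exact Set.indicator_le_indicator_of_subset Set.inter_subset_left (fun _ => zero_le_one' ℝ) ω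
    by_cases hω : ω ∈ E
    · rw [Set.indicator_of_mem hω, Pi.one_apply]
      nlinarith [sq_nonneg (Y ω - e)]
    · have : Y ω = 0 := Finset.sum_eq_zero fun n hn => Set.indicator_of_notMem
        (fun h => hω (Set.mem_biUnion hn h)) _
      rw [Set.indicator_of_notMem hω, this]
      have := sq_nonneg (Y ω)
      linarith
  have hYint : Integrable Y μ := integrable_finsetSum _ fun n _ => hint ((hA n).inter (hB n))
  have hZint : Integrable Z μ := integrable_finsetSum _ fun m _ => integrable_finsetSum _
    fun n _ => hint ((hA m).inter (hA n))
  have hmain := integral_mono (hYint.const_mul (2 * e))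
    (hZint.add ((hint hEm).const_mul (e ^ 2))) hpt
  simp only [Pi.add_apply] at hmain
  rw [integral_const_mul, integral_add hZint ((hint hEm).const_mul (e ^ 2)), integral_const_mul,
    integral_indicator_one hEm, hYI] at hmain
  have hlow : (1 - δ) * e ≤ ∑ n ∈ s, μ.real (A n ∩ B n) := by
    rw [he, Finset.mul_sum]
    exact Finset.sum_le_sum fun n _ => hAB n
  have h1 : 2 * e * ((1 - δ) * e) ≤ e ^ 2 + e + e ^ 2 * μ.real E := by
    have : 2 * e * ((1 - δ) * e) ≤ 2 * e * ∑ n ∈ s, μ.real (A n ∩ B n) := by gcongr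
    linarith
  have h2 : e ^ 2 * (1 - 2 * δ - e⁻¹) ≤ e ^ 2 * μ.real E := by
    have : e ^ 2 * e⁻¹ = e := by field_simp
    nlinarith
  exact le_of_mul_le_mul_left h2 (by positivity)

/-- A Borel–Cantelli lemma for pairwise independent events, thinned by further events of large
conditional probability. -/
theorem measure_not_frequently_le (hA : ∀ n, MeasurableSet (A n)) (hB : ∀ n, MeasurableSet (B n))
    (hind : ∀ m n, m ≠ n → μ.real (A m ∩ A n) = μ.real (A m) * μ.real (A n))
    (hAB : ∀ n, (1 - δ) * μ.real (A n) ≤ μ.real (A n ∩ B n))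
    (hdiv : ¬ Summable fun n => μ.real (A n)) :
    μ {ω | ¬ ∃ᶠ n in atTop, ω ∈ A n ∩ B n} ≤ ENNReal.ofReal (2 * δ) := by
  set D : ℕ → Set Ω := fun N => {ω | ∀ n ≥ N, ω ∉ A n ∩ B n} with hD
  have hset : {ω | ¬ ∃ᶠ n in atTop, ω ∈ A n ∩ B n} = ⋃ N, D N := by
    ext ω
    simp [hD, not_frequently, eventually_atTop]
  have hmono : Monotone D := fun N M hNM ω hω n hn => hω n (hNM.trans hn)
  -- Divergence makes the reciprocal in the second moment bound over `Finset.Ico N M` vanish as `M`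
  -- grows, for each fixed `N`.
  have hbound : ∀ N, μ (D N) ≤ ENNReal.ofReal (2 * δ) := by
    intro N
    have htend := (not_summable_iff_tendsto_nat_atTop_of_nonneg
      (fun n => measureReal_nonneg (μ := μ) (s := A n))).1 hdiv
    have htend' : Tendsto (fun M => ∑ n ∈ Finset.Ico N M, μ.real (A n)) atTop atTop := by
      have := tendsto_atTop_add_const_right _ (-∑ n ∈ Finset.range N, μ.real (A n)) htend
      refine this.congr' ?_
      filter_upwards [eventually_ge_atTop N] with M hM
      rw [Finset.sum_Ico_eq_sub _ hM]
      ring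
    have hle : ∀ᶠ M in atTop, μ.real (D N) ≤
        2 * δ + (∑ n ∈ Finset.Ico N M, μ.real (A n))⁻¹ := by
      filter_upwards [htend'.eventually_gt_atTop 0] with M hM
      have h1 := le_measureReal_biUnion hA hB hind hAB (Finset.Ico N M) hM
      have hm : MeasurableSet (⋃ n ∈ Finset.Ico N M, A n ∩ B n) :=
        Finset.measurableSet_biUnion _ fun n _ => (hA n).inter (hB n)
      have h2 : D N ⊆ (⋃ n ∈ Finset.Ico N M, A n ∩ B n)ᶜ := by
        intro ω hω hmem
        simp only [Set.mem_iUnion] at hmem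
        obtain ⟨n, hn, hmem⟩ := hmem
        exact hω n (Finset.mem_Ico.1 hn).1 hmem
      have h3 := measureReal_mono (μ := μ) h2
      rw [probReal_compl_eq_one_sub hm] at h3
      linarith
    have hlim : Tendsto (fun M => 2 * δ + (∑ n ∈ Finset.Ico N M, μ.real (A n))⁻¹) atTop
        (𝓝 (2 * δ + 0)) := tendsto_const_nhds.add htend'.inv_tendsto_atTop
    have h4 := ge_of_tendsto hlim hle
    rw [add_zero] at h4
    rw [← ofReal_measureReal (μ := μ) (s := D N)]
    exact ENNReal.ofReal_le_ofReal h4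
  rw [hset]
  exact le_of_tendsto' (tendsto_measure_iUnion_atTop hmono) hbound

end BorelCantelli

/-! ### Sums of inverse distances on the circle -/

section Circle

lemma volume_real_closedBall_circle {r : ℝ} (h0 : 0 ≤ r) (h1 : r ≤ 1 / 2) (x : UnitAddCircle) :
    volume.real (Metric.closedBall x r) = 2 * r := by
  rw [Measure.real, AddCircle.volume_closedBall, min_eq_right (by linarith),
    ENNReal.toReal_ofReal (by linarith)]

/-- The active terms form a geometric series that, with the initial 2, adds up to the first power of
two needed to dominate `1 / r`. -/
lemma inv_le_dyadic_sum {r : ℝ} {J : ℕ} (hr : 2⁻¹ ^ (J + 1) ≤ r) :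
    r⁻¹ ≤ 2 + ∑ i ∈ Finset.range J, (2 : ℝ) ^ (i + 1) * (if r ≤ 2⁻¹ ^ (i + 1) then 1 else 0) := by
  induction J with
  | zero =>
    have : r⁻¹ ≤ (2⁻¹ : ℝ)⁻¹ := by
      gcongr
      simpa using hr
    simpa using this
  | succ J ih =>
    have hr0 : 0 < r := lt_of_lt_of_le (by positivity) hr
    rcases le_or_gt (2⁻¹ ^ (J + 1)) r with h | h
    · refine (ih h).trans ?_
      rw [Finset.sum_range_succ]
      have : 0 ≤ (2 : ℝ) ^ (J + 1) * (if r ≤ 2⁻¹ ^ (J + 1) then 1 else 0) := by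
        split_ifs <;> positivity
      linarith
    · have h1 : ∑ i ∈ Finset.range (J + 1), (2 : ℝ) ^ (i + 1) *
          (if r ≤ 2⁻¹ ^ (i + 1) then 1 else 0) = 2 ^ (J + 2) - 2 := by
        have : ∀ i ∈ Finset.range (J + 1), (2 : ℝ) ^ (i + 1) *
            (if r ≤ 2⁻¹ ^ (i + 1) then 1 else 0) = 2 * 2 ^ i := by
          intro i hi
          have hle : (2⁻¹ : ℝ) ^ (J + 1) ≤ 2⁻¹ ^ (i + 1) :=
            pow_le_pow_of_le_one (by norm_num) (by norm_num)
              (Nat.succ_le_succ (Nat.lt_succ_iff.1 (Finset.mem_range.1 hi)))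
          rw [if_pos (h.le.trans hle)]
          ring
        rw [Finset.sum_congr rfl this, ← Finset.mul_sum, geom_sum_eq (by norm_num)]
        ring
      rw [h1]
      have h2 : r⁻¹ ≤ ((2⁻¹ : ℝ) ^ (J + 1 + 1))⁻¹ := by gcongr
      rw [inv_pow, inv_inv] at h2
      linarith

/-- A dyadic majorant of the truncation of the inverse distance to the origin. -/
def dyadicMajorant (J : ℕ) (w : UnitAddCircle) : ℝ :=
  2 + ∑ i ∈ Finset.range J,
    (Metric.closedBall (0 : UnitAddCircle) ((2⁻¹ : ℝ) ^ (i + 1))).indicator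
      (fun _ => (2 : ℝ) ^ (i + 1)) w

lemma inv_norm_le_dyadicMajorant {J : ℕ} {w : UnitAddCircle} (hw : 2⁻¹ ^ (J + 1) ≤ ‖w‖) :
    ‖w‖⁻¹ ≤ dyadicMajorant J w := by
  refine (inv_le_dyadic_sum hw).trans (le_of_eq ?_)
  rw [dyadicMajorant]
  congr 1
  refine Finset.sum_congr rfl fun i _ => ?_
  classical
  rw [Set.indicator_apply, Metric.mem_closedBall, dist_zero_right, mul_ite, mul_one, mul_zero]

lemma dyadicMajorant_nonneg (J : ℕ) (w : UnitAddCircle) : 0 ≤ dyadicMajorant J w :=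
  add_nonneg zero_le_two (Finset.sum_nonneg fun i _ =>
    Set.indicator_nonneg (fun _ _ => by positivity) _)

lemma integrable_indicator_ball (i : ℕ) : Integrable
    ((Metric.closedBall (0 : UnitAddCircle) ((2⁻¹ : ℝ) ^ (i + 1))).indicator
      fun _ => (2 : ℝ) ^ (i + 1)) volume :=
  (integrable_const _).indicator Metric.isClosed_closedBall.measurableSet

lemma integrable_dyadicMajorant (J : ℕ) : Integrable (dyadicMajorant J) volume :=
  (integrable_const _).add (integrable_finsetSum _ fun i _ => integrable_indicator_ball i)

lemma integral_dyadicMajorant (J : ℕ) : ∫ w, dyadicMajorant J w = 2 + 2 * J := by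
  simp only [dyadicMajorant]
  rw [integral_add (integrable_const _) (integrable_finsetSum _ fun i _ =>
    integrable_indicator_ball i), integral_finsetSum _ fun i _ => integrable_indicator_ball i]
  have : ∀ i ∈ Finset.range J, ∫ w : UnitAddCircle,
      (Metric.closedBall (0 : UnitAddCircle) ((2⁻¹ : ℝ) ^ (i + 1))).indicator
        (fun _ => (2 : ℝ) ^ (i + 1)) w = 2 := by
    intro i _
    have hle : (2⁻¹ : ℝ) ^ (i + 1) ≤ 1 / 2 := by
      have := pow_le_pow_of_le_one (by norm_num : (0 : ℝ) ≤ 2⁻¹) (by norm_num)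
        (show 1 ≤ i + 1 by omega)
      linarith [pow_one (2⁻¹ : ℝ)]
    rw [integral_indicator_const _ Metric.isClosed_closedBall.measurableSet,
      volume_real_closedBall_circle (by positivity) hle, smul_eq_mul, mul_assoc, ← mul_pow]
    norm_num
  rw [Finset.sum_congr rfl this]
  simp [mul_comm]

/-- A weak type bound for sums of inverse distances along arbitrary translates. -/
lemma measureReal_sum_inv_gt_le (c : ℕ → UnitAddCircle) (N J : ℕ) {L : ℝ} (hL : 0 < L) :
    volume.real {v : UnitAddCircle | L < ∑ k ∈ Finset.range N, ‖v + c k‖⁻¹} ≤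
      N * 2⁻¹ ^ J + N * (2 + 2 * J) / L := by
  -- The inverse distance is not integrable, so small balls around the poles are discarded first;
  -- Markov's inequality for the truncated majorant handles the rest.
  set S₁ : Set UnitAddCircle :=
    ⋃ k ∈ Finset.range N, Metric.closedBall (-c k) ((2⁻¹ : ℝ) ^ (J + 1)) with hS₁
  set S₂ : Set UnitAddCircle := {v | L ≤ ∑ k ∈ Finset.range N, dyadicMajorant J (v + c k)} with hS₂
  have hsub : {v : UnitAddCircle | L < ∑ k ∈ Finset.range N, ‖v + c k‖⁻¹} ⊆ S₁ ∪ S₂ := by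
    intro v hv
    by_cases h1 : v ∈ S₁
    · exact Or.inl h1
    refine Or.inr (le_trans (le_of_lt hv) (Finset.sum_le_sum fun k hk => ?_) : L ≤ _)
    refine inv_norm_le_dyadicMajorant ?_
    by_contra! hlt
    refine h1 (Set.mem_biUnion hk ?_)
    rw [Metric.mem_closedBall, dist_eq_norm, sub_neg_eq_add]
    exact hlt.le
  have hle : (2⁻¹ : ℝ) ^ (J + 1) ≤ 1 / 2 := by
    have := pow_le_pow_of_le_one (by norm_num : (0 : ℝ) ≤ 2⁻¹) (by norm_num)
      (show 1 ≤ J + 1 by omega)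
    linarith [pow_one (2⁻¹ : ℝ)]
  have h1 : volume.real S₁ ≤ N * 2⁻¹ ^ J := by
    refine (measureReal_biUnion_finset_le _ _).trans (le_of_eq ?_)
    simp_rw [volume_real_closedBall_circle (by positivity) hle]
    rw [Finset.sum_const, Finset.card_range, nsmul_eq_mul, pow_succ]
    ring
  have hint : ∀ k, Integrable (fun v => dyadicMajorant J (v + c k)) volume := fun k =>
    (integrable_dyadicMajorant J).comp_add_right (c k)
  have h2 : volume.real S₂ ≤ N * (2 + 2 * J) / L := by
    have := mul_meas_ge_le_integral_of_nonneg (μ := (volume : Measure UnitAddCircle))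
      (f := fun v => ∑ k ∈ Finset.range N, dyadicMajorant J (v + c k))
      (Eventually.of_forall fun v => Finset.sum_nonneg fun k _ => dyadicMajorant_nonneg J _)
      (integrable_finsetSum _ fun k _ => hint k) L
    rw [integral_finsetSum _ fun k _ => hint k] at this
    simp_rw [integral_add_right_eq_self (dyadicMajorant J), integral_dyadicMajorant] at this
    rw [Finset.sum_const, Finset.card_range, nsmul_eq_mul] at this
    rw [le_div_iff₀ hL, mul_comm]
    exact this
  calc _ ≤ volume.real (S₁ ∪ S₂) := measureReal_mono hsub
    _ ≤ volume.real S₁ + volume.real S₂ := measureReal_union_le _ _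
    _ ≤ _ := add_le_add h1 h2

/-- The sums of inverse distances over `2 ^ (j + 2)` points are of order `(j + 1) 2 ^ j`, up to
small probability. -/
lemma exists_measureReal_sum_inv_gt_le {δ : ℝ} (hδ : 0 < δ) :
    ∃ C > 0, ∀ (c : ℕ → UnitAddCircle) (j : ℕ),
      volume.real {v : UnitAddCircle | C * ((j + 1) * 2 ^ j) <
        ∑ k ∈ Finset.range (2 ^ (j + 2)), ‖v + c k‖⁻¹} ≤ δ := by
  -- Truncating at level `j + 2 + s`, the discarded balls have measure at most `2⁻¹ ^ s`, less than
  -- `δ / 2`; the constant is tuned so that Markov's term is at most `δ / 2`.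
  obtain ⟨s, hs⟩ := exists_pow_lt_of_lt_one (half_pos hδ) (by norm_num : (2⁻¹ : ℝ) < 1)
  have hC : 0 < 8 * (6 + 2 * (s : ℝ)) / δ := by positivity
  refine ⟨8 * (6 + 2 * (s : ℝ)) / δ, hC, fun c j => ?_⟩
  refine (measureReal_sum_inv_gt_le c (2 ^ (j + 2)) (j + 2 + s) (by positivity)).trans ?_
  have h1 : ((2 ^ (j + 2) : ℕ) : ℝ) * 2⁻¹ ^ (j + 2 + s) = 2⁻¹ ^ s := by
    rw [pow_add _ (j + 2), ← mul_assoc]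
    push_cast
    rw [← mul_pow]
    norm_num
  have h2 : ((2 ^ (j + 2) : ℕ) : ℝ) * (2 + 2 * ((j + 2 + s : ℕ) : ℝ)) /
      (8 * (6 + 2 * (s : ℝ)) / δ * ((j + 1) * 2 ^ j)) ≤ δ / 2 := by
    rw [div_le_iff₀ (by positivity)]
    have e : δ / 2 * (8 * (6 + 2 * (s : ℝ)) / δ * ((j + 1) * 2 ^ j)) =
        (4 * 2 ^ j) * ((6 + 2 * s) * (j + 1)) := by
      field_simp
      ring
    rw [e]
    push_cast
    rw [pow_add, mul_comm ((2 : ℝ) ^ j) (2 ^ 2)]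
    norm_num
    have hj : (0 : ℝ) ≤ j := by positivity
    have hs' : (0 : ℝ) ≤ s := by positivity
    nlinarith [mul_nonneg hj hs']
  rw [h1]
  linarith

end Circle

/-! ### Pairwise independence of shears -/

section Independence

lemma measurePreserving_shear (m : ℤ) :
    MeasurePreserving (fun z : UnitAddCircle × UnitAddCircle => (z.1, z.2 + m • z.1))
      volume volume := by
  refine MeasurePreserving.skew_product (g := fun α u => u + m • α) (MeasurePreserving.id volume)
    (by fun_prop) (Eventually.of_forall fun α => ?_)
  exact map_add_right_eq_self volume (m • α)

lemma volume_shear_preimage (m : ℤ) {K : Set UnitAddCircle} (hK : MeasurableSet K) :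
    volume {z : UnitAddCircle × UnitAddCircle | z.2 + m • z.1 ∈ K} = volume K := by
  have := (measurePreserving_shear m).measure_preimage
    ((MeasurableSet.univ (α := UnitAddCircle)).prod hK).nullMeasurableSet
  rw [Measure.volume_eq_prod, Measure.prod_prod, measure_univ, one_mul] at this
  rw [← this]
  congr 1
  ext z
  simp

/-- Distinct shears of the torus are independent. -/
lemma volume_shear_inter {m n : ℤ} (hmn : m ≠ n) {K K' : Set UnitAddCircle}
    (hK : MeasurableSet K) (hK' : MeasurableSet K') :
    volume {z : UnitAddCircle × UnitAddCircle | z.2 + m • z.1 ∈ K ∧ z.2 + n • z.1 ∈ K'} =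
      volume K * volume K' := by
  have hmeas : MeasurableSet
      {z : UnitAddCircle × UnitAddCircle | z.2 + (m - n) • z.1 ∈ K ∧ z.2 ∈ K'} :=
    (hK.preimage (by fun_prop)).inter (hK'.preimage measurable_snd)
  have h1 := (measurePreserving_shear n).measure_preimage hmeas.nullMeasurableSet
  have h2 : (fun z : UnitAddCircle × UnitAddCircle => (z.1, z.2 + n • z.1)) ⁻¹'
      {z | z.2 + (m - n) • z.1 ∈ K ∧ z.2 ∈ K'} =
      {z | z.2 + m • z.1 ∈ K ∧ z.2 + n • z.1 ∈ K'} := by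
    ext z
    have : z.2 + n • z.1 + (m - n) • z.1 = z.2 + m • z.1 := by
      rw [add_assoc, ← add_smul]
      congr 2
      ring
    simp [this]
  rw [← h2, h1, Measure.volume_eq_prod, Measure.prod_apply_symm hmeas]
  have h3 : ∀ u : UnitAddCircle, volume ((fun α : UnitAddCircle => (α, u)) ⁻¹'
      {z : UnitAddCircle × UnitAddCircle | z.2 + (m - n) • z.1 ∈ K ∧ z.2 ∈ K'}) =
      K'.indicator (fun _ => volume K) u := by
    intro u
    by_cases hu : u ∈ K'
    · rw [Set.indicator_of_mem hu]
      -- With `u` frozen, a non-zero multiple of a uniform `α` is still uniform; this is the source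
      -- of the independence.
      have hmp : MeasurePreserving (fun α : UnitAddCircle => u + (m - n) • α) volume volume :=
        (measurePreserving_add_left volume u).comp
          (Measure.measurePreserving_zsmul volume (sub_ne_zero.2 hmn))
      rw [← hmp.measure_preimage hK.nullMeasurableSet]
      congr 1
      ext α
      simp [hu]
    · rw [Set.indicator_of_notMem hu]
      simp [hu]
  simp_rw [h3]
  rw [lintegral_indicator_const hK']

end Independence

/-! ### Almost every triple has dominant close returns -/

section Dominant

/-- The parameter space of triples `((α, u), v)`. -/
abbrev Params : Type := (UnitAddCircle × UnitAddCircle) × UnitAddCircle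

/-- Target radii, decaying like `1 / (n log n)`. -/
def radius (η : ℝ) (n : ℕ) : ℝ := η / ((Nat.log 2 n + 1) * 2 ^ Nat.log 2 n)

lemma radius_nonneg {η : ℝ} (hη : 0 ≤ η) (n : ℕ) : 0 ≤ radius η n := by
  rw [radius]
  positivity

lemma radius_le {η : ℝ} (hη : 0 ≤ η) (n : ℕ) : radius η n ≤ η := by
  refine div_le_self hη ?_
  have h1 : (1 : ℝ) ≤ (Nat.log 2 n : ℝ) + 1 := by
    have : (0 : ℝ) ≤ Nat.log 2 n := by positivity
    linarith
  have h2 : (1 : ℝ) ≤ 2 ^ Nat.log 2 n := one_le_pow₀ (by norm_num)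
  nlinarith

/-- Cauchy condensation gives `η` times the harmonic series. Divergence for every `η > 0` is what
lets `η` be chosen after the constant of the tame events. -/
lemma not_summable_radius {η : ℝ} (hη : 0 < η) : ¬ Summable (radius η) := by
  have hanti : ∀ ⦃m n : ℕ⦄, 0 < m → m ≤ n → radius η n ≤ radius η m := by
    intro m n _ hmn
    have hlog : Nat.log 2 m ≤ Nat.log 2 n := Nat.log_mono_right hmn
    rw [radius, radius]
    gcongr
    norm_num
  rw [← summable_condensed_iff_of_nonneg (radius_nonneg hη.le) hanti]
  intro hsum
  have h1 : (fun k : ℕ => (2 : ℝ) ^ k * radius η (2 ^ k)) =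
      fun k : ℕ => η * (1 / ((k : ℝ) + 1)) := by
    funext k
    rw [radius, Nat.log_pow (by norm_num)]
    field_simp
  rw [h1, summable_mul_left_iff hη.ne'] at hsum
  have h2 := (summable_nat_add_iff (f := fun k : ℕ => 1 / (k : ℝ)) 1).1 (by simpa using hsum)
  exact Real.not_summable_one_div_natCast h2

/-- The event of a close return at time `n`. -/
def hitEvent (η : ℝ) (n : ℕ) : Set Params :=
  {z : UnitAddCircle × UnitAddCircle |
    z.2 + (n : ℤ) • z.1 ∈ Metric.closedBall (0 : UnitAddCircle) (radius η n)} ×ˢ Set.univ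

/-- The event that the competing sum is of its typical size. -/
def tameEvent (C : ℝ) (n : ℕ) : Set Params :=
  {ω | ∑ k ∈ Finset.range (2 ^ (Nat.log 2 n + 2)), ‖ω.2 + ((k : ℤ) - 1) • ω.1.1‖⁻¹ ≤
    C * ((Nat.log 2 n + 1) * 2 ^ Nat.log 2 n)}

lemma measurableSet_hitEvent (η : ℝ) (n : ℕ) : MeasurableSet (hitEvent η n) :=
  (Metric.isClosed_closedBall.measurableSet.preimage (by fun_prop)).prod MeasurableSet.univ

lemma measurableSet_tameEvent (C : ℝ) (n : ℕ) : MeasurableSet (tameEvent C n) :=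
  measurableSet_le (Finset.measurable_sum _ fun k _ =>
    (Measurable.norm (by fun_prop)).inv) measurable_const

lemma measureReal_hitEvent {η : ℝ} (h0 : 0 ≤ η) (h1 : η ≤ 1 / 2) (n : ℕ) :
    volume.real (hitEvent η n) = 2 * radius η n := by
  rw [hitEvent, Measure.volume_eq_prod, measureReal_prod_prod, probReal_univ, mul_one,
    Measure.real, volume_shear_preimage _ Metric.isClosed_closedBall.measurableSet]
  exact volume_real_closedBall_circle (radius_nonneg h0 n) ((radius_le h0 n).trans h1) 0

lemma measureReal_hitEvent_inter {η : ℝ} {m n : ℕ}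
    (hmn : m ≠ n) : volume.real (hitEvent η m ∩ hitEvent η n) =
      volume.real (hitEvent η m) * volume.real (hitEvent η n) := by
  have hK : ∀ r : ℝ, MeasurableSet (Metric.closedBall (0 : UnitAddCircle) r) := fun r =>
    Metric.isClosed_closedBall.measurableSet
  simp only [Measure.real, ← ENNReal.toReal_mul]
  congr 1
  rw [hitEvent, hitEvent, Set.prod_inter_prod, Set.univ_inter, Measure.volume_eq_prod,
    Measure.prod_prod, Measure.prod_prod, Measure.prod_prod, measure_univ, mul_one, mul_one,
    mul_one, volume_shear_preimage _ (hK _), volume_shear_preimage _ (hK _)]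
  exact volume_shear_inter (by exact_mod_cast hmn) (hK _) (hK _)

/-- A hit depends on `(α, u)` only, and the bound in `v` is uniform over translates, so Fubini over
`v` gives the conditional probability. -/
lemma le_measureReal_hit_inter_tame {δ C η : ℝ} (hδ : 0 ≤ δ)
    (hC : ∀ (c : ℕ → UnitAddCircle) (j : ℕ), volume.real {v : UnitAddCircle |
      C * ((j + 1) * 2 ^ j) < ∑ k ∈ Finset.range (2 ^ (j + 2)), ‖v + c k‖⁻¹} ≤ δ) (n : ℕ) :
    (1 - δ) * volume.real (hitEvent η n) ≤ volume.real (hitEvent η n ∩ tameEvent C n) := by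
  have hmeas := (measurableSet_hitEvent η n).diff (measurableSet_tameEvent C n)
  have h1 : volume (hitEvent η n \ tameEvent C n) ≤ ENNReal.ofReal δ * volume (hitEvent η n) := by
    rw [Measure.volume_eq_prod, Measure.prod_apply hmeas,
      Measure.prod_apply (measurableSet_hitEvent η n), ← lintegral_const_mul _
        (measurable_measure_prodMk_left (measurableSet_hitEvent η n))]
    refine lintegral_mono fun z => ?_
    by_cases hz : z ∈ {z : UnitAddCircle × UnitAddCircle |
        z.2 + (n : ℤ) • z.1 ∈ Metric.closedBall (0 : UnitAddCircle) (radius η n)}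
    · have e1 : Prod.mk z ⁻¹' hitEvent η n = (Set.univ : Set UnitAddCircle) := by
        ext v
        simpa [hitEvent] using hz
      rw [e1, measure_univ, mul_one]
      have e2 := hC (fun k => ((k : ℤ) - 1) • z.1) (Nat.log 2 n)
      rw [← ofReal_measureReal (μ := (volume : Measure UnitAddCircle))]
      refine ENNReal.ofReal_le_ofReal (le_trans (measureReal_mono ?_) e2)
      intro v hv
      have hv2 : (z, v) ∉ tameEvent C n := hv.2
      rw [tameEvent, Set.mem_ofPred_eq, not_le] at hv2
      exact hv2
    · have e1 : Prod.mk z ⁻¹' (hitEvent η n \ tameEvent C n) = ∅ := by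
        ext v
        simp only [hitEvent, Set.mem_preimage, Set.mem_sdiff, Set.mem_prod, Set.mem_univ, and_true,
          Set.mem_empty_iff_false, iff_false, not_and]
        exact fun h => absurd h hz
      rw [e1, measure_empty]
      exact zero_le
  have h2 : volume.real (hitEvent η n \ tameEvent C n) ≤ δ * volume.real (hitEvent η n) := by
    have := ENNReal.toReal_mono (ENNReal.mul_ne_top ENNReal.ofReal_ne_top (measure_ne_top _ _)) h1
    rwa [ENNReal.toReal_mul, ENNReal.toReal_ofReal hδ] at this
  have h3 := measureReal_inter_add_sdiff (μ := (volume : Measure Params)) (s := hitEvent η n)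
    (measurableSet_tameEvent C n)
  linarith

/-- The radius of the hit and the tame threshold are reciprocal up to `η` and `C`; the dyadic block
of length `2 ^ (Nat.log 2 n + 2)` contains all `n + 3` terms. -/
lemma norm_mul_crossingSum_le {C η : ℝ} (hη : 0 ≤ η) {n : ℕ} {ω : Params}
    (hω : ω ∈ hitEvent η n ∩ tameEvent C n) :
    ‖ω.1.2 + (n : ℤ) • ω.1.1‖ * crossingSum ω.1.1 ω.2 n ≤ η * C := by
  obtain ⟨⟨h1, -⟩, h2⟩ := hω
  have h1' : ‖ω.1.2 + (n : ℤ) • ω.1.1‖ ≤ radius η n := by simpa using h1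
  have hlt : n < 2 ^ (Nat.log 2 n + 1) := Nat.lt_pow_succ_log_self (by norm_num) n
  have hle : n + 3 ≤ 2 ^ (Nat.log 2 n + 2) := by
    have e1 : 2 ^ (Nat.log 2 n + 2) = 2 * 2 ^ (Nat.log 2 n + 1) := by ring
    have e2 : 2 ≤ 2 ^ (Nat.log 2 n + 1) := by
      calc 2 = 2 ^ 1 := rfl
        _ ≤ 2 ^ (Nat.log 2 n + 1) := Nat.pow_le_pow_right (by norm_num) (by omega)
    omega
  have h3 : crossingSum ω.1.1 ω.2 n ≤ C * ((Nat.log 2 n + 1) * 2 ^ Nat.log 2 n) :=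
    (Finset.sum_le_sum_of_subset_of_nonneg (Finset.range_subset_range.2 hle)
      fun _ _ _ => by positivity).trans h2
  have h4 : 0 ≤ crossingSum ω.1.1 ω.2 n := Finset.sum_nonneg fun _ _ => by positivity
  calc _ ≤ radius η n * (C * ((Nat.log 2 n + 1) * 2 ^ Nat.log 2 n)) :=
        mul_le_mul h1' h3 h4 (radius_nonneg hη n)
    _ = η * C := by
        rw [radius]
        field_simp

lemma ae_frequently {ε : ℝ} (hε : 0 < ε) : ∀ᵐ ω : Params,
    ∃ᶠ n : ℕ in atTop, ‖ω.1.2 + (n : ℤ) • ω.1.1‖ * crossingSum ω.1.1 ω.2 n < ε := by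
  rw [ae_iff]
  refine le_antisymm (ENNReal.le_of_forall_pos_le_add fun δ hδ _ => ?_) zero_le
  have hδ' : (0 : ℝ) < δ / 2 := by positivity
  -- `δ / 2` offsets the factor 2 lost in the Borel–Cantelli bound.
  obtain ⟨C, hC0, hC⟩ := exists_measureReal_sum_inv_gt_le hδ'
  set η := min (1 / 2) (ε / (2 * C)) with hη
  have hη0 : 0 < η := by positivity
  have hηC : η * C < ε := by
    have : η * C ≤ ε / (2 * C) * C := by
      gcongr
      exact min_le_right _ _
    have e : ε / (2 * C) * C = ε / 2 := by field_simp
    linarith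
  have hdiv : ¬ Summable fun n => (volume : Measure Params).real (hitEvent η n) := by
    simp_rw [measureReal_hitEvent hη0.le (min_le_left _ _)]
    rw [summable_mul_left_iff two_ne_zero]
    exact not_summable_radius hη0
  have hmain := measure_not_frequently_le (measurableSet_hitEvent η) (measurableSet_tameEvent C)
    (fun m n hmn => measureReal_hitEvent_inter hmn)
    (le_measureReal_hit_inter_tame hδ'.le hC) hdiv
  refine (measure_mono ?_).trans (hmain.trans ?_)
  · intro ω hω
    rw [Set.mem_ofPred_eq] at hω ⊢
    refine fun hfr => hω (hfr.mono fun n hn => ?_)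
    exact (norm_mul_crossingSum_le hη0.le hn).trans_lt hηC
  · rw [zero_add, mul_div_cancel₀ _ two_ne_zero, ENNReal.ofReal_coe_nnreal]

lemma ae_isDominant : ∀ᵐ α : UnitAddCircle, ∀ᵐ u : UnitAddCircle, ∀ᵐ v : UnitAddCircle,
    IsDominant α u v := by
  have h1 : ∀ᵐ ω : Params, ∀ m : ℕ, ∃ᶠ n : ℕ in atTop,
      ‖ω.1.2 + (n : ℤ) • ω.1.1‖ * crossingSum ω.1.1 ω.2 n < 1 / ((m : ℝ) + 1) :=
    ae_all_iff.2 fun m => ae_frequently (by positivity)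
  have h2 := Measure.ae_ae_of_ae_prod (Measure.ae_ae_of_ae_prod h1)
  have hne : ∀ α : UnitAddCircle, ∀ᵐ u : UnitAddCircle, ∀ k : ℤ, u + k • α ≠ 0 := by
    intro α
    refine ae_all_iff.2 fun k => ?_
    have h0 : volume ({-(k • α)} : Set UnitAddCircle) = 0 := by
      rw [← Metric.closedBall_zero, AddCircle.volume_closedBall]
      simp
    filter_upwards [compl_mem_ae_iff.2 h0] with u hu h
    exact hu (eq_neg_of_add_eq_zero_left h)
  filter_upwards [h2] with α hα
  filter_upwards [hα, hne α] with u hu hu'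
  filter_upwards [hu, hne α] with v hv hv'
  refine ⟨hu', hv', fun ε hε => ?_⟩
  obtain ⟨m, hm⟩ := exists_nat_one_div_lt hε
  exact (hv m).mono fun n hn => hn.trans hm

lemma measurableSet_isDominant :
    MeasurableSet {z : UnitAddCircle × UnitAddCircle × UnitAddCircle |
      IsDominant z.1 z.2.1 z.2.2} := by
  have heq : {z : UnitAddCircle × UnitAddCircle × UnitAddCircle | IsDominant z.1 z.2.1 z.2.2} =
      (⋂ k : ℤ, {z | z.2.1 + k • z.1 ≠ 0}) ∩ ((⋂ k : ℤ, {z | z.2.2 + k • z.1 ≠ 0}) ∩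
        ⋂ m : ℕ, ⋂ N : ℕ, ⋃ n : ℕ, ⋃ _ : N ≤ n,
          {z | ‖z.2.1 + (n : ℤ) • z.1‖ * crossingSum z.1 z.2.2 n < 1 / ((m : ℝ) + 1)}) := by
    ext z
    simp only [Set.mem_ofPred_eq, Set.mem_inter_iff, Set.mem_iInter, Set.mem_iUnion, IsDominant,
      frequently_atTop, exists_prop]
    refine and_congr_right fun _ => and_congr_right fun _ =>
      ⟨fun h m => h _ (by positivity), fun h ε hε N => ?_⟩
    obtain ⟨m, hm⟩ := exists_nat_one_div_lt hε
    obtain ⟨n, hn, hlt⟩ := h m N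
    exact ⟨n, hn, hlt.trans hm⟩
  rw [heq]
  have hne : ∀ (g : UnitAddCircle × UnitAddCircle × UnitAddCircle → UnitAddCircle),
      Measurable g → MeasurableSet {z | g z ≠ 0} := fun g hg =>
    (measurableSet_singleton (0 : UnitAddCircle)).compl.preimage hg
  refine (MeasurableSet.iInter fun k => hne _ (by fun_prop)).inter
    ((MeasurableSet.iInter fun k => hne _ (by fun_prop)).inter
      (MeasurableSet.iInter fun m => MeasurableSet.iInter fun N => MeasurableSet.iUnion fun n =>
        MeasurableSet.iUnion fun _ => measurableSet_lt (Measurable.mul ?_ ?_) measurable_const))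
  · exact Measurable.norm (by fun_prop)
  · exact Finset.measurable_sum _ fun k _ => (Measurable.norm (by fun_prop)).inv

end Dominant

/-! ### From rotation parameters to zeros and starting points -/

section Transfer

lemma measurable_fundLift : Measurable fundLift :=
  measurable_subtype_coe.comp (AddCircle.measurableEquivIco 1 0).measurable

lemma measurable_offset : Measurable fun w : ℝ × Torus2 => offset w.1 w.2 := by
  have h : Measurable fun w : ℝ × Torus2 => w.1 * fundLift w.2.1 :=
    measurable_fst.mul (measurable_fundLift.comp (measurable_fst.comp measurable_snd))
  exact (AddCircle.measurable_mk'.comp h).sub (measurable_snd.comp measurable_snd)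

/-- For a fixed first coordinate the offset is a reflection of the circle in the second one. -/
lemma measurePreserving_offset (a : ℝ) : MeasurePreserving (offset a) volume volume := by
  have h1 : MeasurePreserving
      (fun z : Torus2 => (z.1, ((a * fundLift z.1 : ℝ) : UnitAddCircle) - z.2)) volume volume := by
    refine MeasurePreserving.skew_product (MeasurePreserving.id volume)
      (g := fun z₁ z₂ => ((a * fundLift z₁ : ℝ) : UnitAddCircle) - z₂) ?_
      (Eventually.of_forall fun z₁ => ?_)
    · exact (AddCircle.measurable_mk'.comp
        (measurable_const.mul (measurable_fundLift.comp measurable_fst))).sub measurable_snd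
    · exact (Measure.measurePreserving_sub_left volume
        ((a * fundLift z₁ : ℝ) : UnitAddCircle)).map_eq
  exact measurePreserving_snd.comp h1

lemma measurePreserving_offset_sub (a : ℝ) (x : Torus2) :
    MeasurePreserving (fun p => offset a (p - x)) volume volume :=
  (measurePreserving_offset a).comp (measurePreserving_sub_right volume x)

/-- For almost all parameters and almost all points, close returns to the first zero dominate. -/
lemma ae_ae_isDominant (m : ℤ) : ∀ᵐ ω : UnitAddCircle × Torus2 × Torus2, ∀ᵐ x : Torus2,
    IsDominant ω.1 (offset (fundLift ω.1 + m) (ω.2.1 - x))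
      (offset (fundLift ω.1 + m) (ω.2.2 - x)) := by
  have hmeas : MeasurableSet {z : (UnitAddCircle × Torus2 × Torus2) × Torus2 |
      IsDominant z.1.1 (offset (fundLift z.1.1 + m) (z.1.2.1 - z.2))
        (offset (fundLift z.1.1 + m) (z.1.2.2 - z.2))} := by
    have hf : Measurable fun z : (UnitAddCircle × Torus2 × Torus2) × Torus2 =>
        fundLift z.1.1 + m :=
      (measurable_fundLift.comp (measurable_fst.comp measurable_fst)).add_const _
    refine measurableSet_isDominant.preimage
      (f := fun z : (UnitAddCircle × Torus2 × Torus2) × Torus2 =>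
      (z.1.1, offset (fundLift z.1.1 + m) (z.1.2.1 - z.2),
        offset (fundLift z.1.1 + m) (z.1.2.2 - z.2))) ?_
    refine (measurable_fst.comp measurable_fst).prodMk (Measurable.prodMk ?_ ?_)
    · exact measurable_offset.comp (hf.prodMk (by fun_prop))
    · exact measurable_offset.comp (hf.prodMk (by fun_prop))
  -- After the exchange `x` is fixed, and for each `α` the two offsets are independent and uniform
  -- in the two zeros.
  rw [Measure.ae_ae_comm hmeas]
  refine Eventually.of_forall fun x => ?_
  have hsec : MeasurableSet {ω : UnitAddCircle × Torus2 × Torus2 |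
      IsDominant ω.1 (offset (fundLift ω.1 + m) (ω.2.1 - x))
        (offset (fundLift ω.1 + m) (ω.2.2 - x))} :=
    hmeas.preimage (f := fun ω => (ω, x)) (by fun_prop)
  refine (Measure.ae_prod_iff_ae_ae hsec).2 ?_
  filter_upwards [ae_isDominant] with α hα
  refine (Measure.ae_prod_iff_ae_ae (hsec.preimage (f := fun w => (α, w)) (by fun_prop))).2 ?_
  filter_upwards [(measurePreserving_offset_sub (fundLift α + m)
    x).quasiMeasurePreserving.ae hα] with p hp
  exact (measurePreserving_offset_sub (fundLift α + m) x).quasiMeasurePreserving.ae hp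

lemma ae_irrational : ∀ᵐ α : UnitAddCircle, Irrational (fundLift α) := by
  have hc : (Set.range fun r : ℚ => ((r : ℝ) : UnitAddCircle)).Countable := Set.countable_range _
  have h0 : volume (Set.range fun r : ℚ => ((r : ℝ) : UnitAddCircle)) = 0 :=
    (measure_null_iff_singleton hc).2 fun x _ => by
      rw [← Metric.closedBall_zero, AddCircle.volume_closedBall]
      simp
  filter_upwards [compl_mem_ae_iff.2 h0] with α hα
  rintro ⟨r, hr⟩
  exact hα ⟨r, by simp only [hr, coe_fundLift]⟩

/-- The parameters for which the main theorem holds. -/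
def goodParams : Set (UnitAddCircle × Torus2 × Torus2) :=
  {ω | Irrational (fundLift ω.1) ∧ ∀ m : ℤ, ∀ᵐ x : Torus2,
    IsDominant ω.1 (offset (fundLift ω.1 + m) (ω.2.1 - x))
      (offset (fundLift ω.1 + m) (ω.2.2 - x)) ∧
    IsDominant ω.1 (offset (fundLift ω.1 + m) (ω.2.2 - x))
      (offset (fundLift ω.1 + m) (ω.2.1 - x))}

lemma volume_compl_goodParams : volume goodParamsᶜ = 0 := by
  have h1 : ∀ᵐ ω : UnitAddCircle × Torus2 × Torus2, Irrational (fundLift ω.1) :=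
    (Measure.quasiMeasurePreserving_fst (μ := (volume : Measure UnitAddCircle))
      (ν := (volume : Measure (Torus2 × Torus2)))).ae ae_irrational
  -- Exchanging the zeros preserves the measure, so dominance also holds the other way round.
  have hswap : MeasurePreserving
      (Prod.map id Prod.swap : UnitAddCircle × Torus2 × Torus2 → UnitAddCircle × Torus2 × Torus2)
      volume volume :=
    (MeasurePreserving.id (volume : Measure UnitAddCircle)).prod
      (Measure.measurePreserving_swap (μ := (volume : Measure Torus2))
        (ν := (volume : Measure Torus2)))
  have h2 := ae_all_iff.2 ae_ae_isDominant
  have h3 := hswap.quasiMeasurePreserving.ae h2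
  rw [← mem_ae_iff]
  filter_upwards [h1, h2, h3] with ω hω1 hω2 hω3
  exact ⟨hω1, fun m => (hω2 m).and (hω3 m)⟩

end Transfer

/-- For good parameters, the slowed down flow has extreme historic behavior. -/
theorem hasExtremeHistoricBehavior_of_mem {α : UnitAddCircle} {p q : Torus2}
    (hF : (α, p, q) ∈ goodParams) {a : ℝ} (ha : (a : UnitAddCircle) = α) {φ : Torus2 → ℝ}
    (h : IsStoppingFunction φ p q) {T : Flow ℝ Torus2} (hT : IsGeneratedBy T φ a) :
    HasExtremeHistoricBehavior T ∧ invariantMeasures T = diracSegment p q := by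
  obtain ⟨hirr, hdom⟩ := hF
  -- The offsets depend on the real slope and not only on its class, which is why `goodParams`
  -- ranges over all integers `m`.
  obtain ⟨m, hm⟩ := exists_int_of_coe_eq (ha.trans (coe_fundLift α).symm)
  have hirr' : Irrational a := hm ▸ hirr.add_intCast m
  have hdom' := hdom m
  simp only [← hm] at hdom'
  subst ha
  have hinv := h.invariantMeasures_eq hirr' hT
  refine ⟨?_, hinv⟩
  filter_upwards [hdom'] with x hx
  rw [hinv]
  refine (h.accumulationMeasures_subset hirr' hT x).antisymm
    (h.diracSegment_subset hirr' hT x ?_ ?_)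
  · exact fun g hg hgp ε hε N => hx.1.exists_empirical_lt h hT g hg hgp ε hε N
  · exact fun g hg hgq ε hε N => hx.2.exists_empirical_lt h.symm hT g hg hgq ε hε N

end TorusFlow

end

/-- There is a full-measure set `F` of parameters `(α, p, q)` such that for every `(α, p, q)` in `F`,
every real representative `a` of `α` and every `C³` non-negative `φ` with exactly the two
non-degenerate zeros `p` and `q`, the vector field `φ · (1, a)` generates a flow, and this flow
has extreme historic behavior, its invariant probability measures being exactly the convex
combinations of `δ_p` and `δ_q`. -/
theorem mainTheorem4 :
    ∃ F : Set (UnitAddCircle × TorusFlow.Torus2 × TorusFlow.Torus2),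
      MeasureTheory.volume Fᶜ = 0 ∧
      ∀ (α : UnitAddCircle) (p q : TorusFlow.Torus2), (α, p, q) ∈ F →
        ∀ a : ℝ, (a : UnitAddCircle) = α →
        ∀ φ : TorusFlow.Torus2 → ℝ, TorusFlow.IsStoppingFunction φ p q →
          (∃ T : Flow ℝ TorusFlow.Torus2, TorusFlow.IsGeneratedBy T φ a) ∧
          ∀ T : Flow ℝ TorusFlow.Torus2, TorusFlow.IsGeneratedBy T φ a →
            TorusFlow.HasExtremeHistoricBehavior T ∧
            TorusFlow.invariantMeasures T = TorusFlow.diracSegment p q := by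
  refine ⟨TorusFlow.goodParams, TorusFlow.volume_compl_goodParams, ?_⟩
  intro α p q hF a ha φ hφ
  exact ⟨hφ.exists_flow a, fun T hT => TorusFlow.hasExtremeHistoricBehavior_of_mem hF ha hφ hT⟩
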